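/- Let $\Omega\subset\mathbb{R}^3$ be a bounded open set, and let $\mu,\alpha,N>0$, $1\le\beta\le 3$ and $\tau\in\mathbb{R}$. Let $\mathcal V=\{\varphi\in (C_0^\infty(\Omega))^3:\operatorname{div}\varphi=0\}$, let $H$ be the closure of $\mathcal V$ in $(L^2(\Omega))^3$, with inner product $(\cdot,\cdot)$, and let $V$ be the closure of $\mathcal V$ in $(H_0^1(\Omega))^3$, with inner product $((u,v))=\sum_{i=1}^3\int_\Omega \partial_i u\cdot\partial_i v\,dx$ and norm $\|u\|=((u,u))^{1/2}$. Put $F_N(r)=\min(1,N/r)$ for $r>0$, $F_N(0)=1$, and $$b(u,v,w)=\sum_{i,j=1}^3\int_\Omega u_i\,\frac{\partial v_j}{\partial x_i}\,w_j\,dx\qquad(u,v,w\in V).$$ Let $u_\tau\in H$ and let $f\in L^2(\tau,T;H)$ for all $T>\tau$. For $T>\tau$, a weak solution on $[\tau,T]$ of the globally modified Navier–Stokes equations with damping $$u_t-\mu\Delta u+F_N(\|u\|)(u\cdot\nabla)u+\nabla p+\alpha F_N(\|u\|^{\beta-1})|u|^{\beta-1}u=f,\quad \operatorname{div}u=0,\quad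 u|_{\partial\Omega}=0,\quad u(\tau)=u_\tau,$$ is a function $u\in L^\infty(\tau,T;H)\cap L^2(\tau,T;V)$ with $F_N(\|u\|^{\beta-1})u\in L^{\beta+1}(\tau,T;(L^{\beta+1}(\Omega))^3)$ such that, for every $w\in V\cap(L^{\beta+1}(\Omega))^3$, $$\frac{d}{dt}(u,w)+\mu((u,w))+F_N(\|u\|)\,b(u,u,w)+\alpha F_N(\|u\|^{\beta-1})\int_\Omega|u|^{\beta-1}u\cdot w\,dx=(f,w)$$ in the sense of scalar distributions on $(\tau,T)$, and such that $u(\tau)=u_\tau$, where $u(\tau)$ is the value at $\tau$ of the representative of $u$ that is continuous from $[\tau,T]$ to $H$ with its weak topology. A global weak solution is a function on $[\tau,\infty)$ that is a weak solution on $[\tau,T]$ for every $T>\tau$. Then the weak solution is unique: for every $T>\tau$, any two weak solutions $u,v$ on $[\tau,T]$ (with the same $f$ and $u_\tau$) coincide, that is, $u(t)=v(t)$ for almost every $t\in(\tau,T)$, and for every $t\in[\tau,T]$ if $u$ and $v$ are weakly continuous from $[\tau,T]$ to $H$. Likewise, any two global weak solutions coincide almost everywhere on $(\tau,\infty)$,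 and everywhere on $[\tau,\infty)$ if they are weakly continuous. -/

import Mathlib

open MeasureTheory Set Filter Topology
open scoped ENNReal ContDiff

noncomputable section

namespace GMNSED

/-- Three-dimensional Euclidean space. -/
abbrev E3 : Type := EuclideanSpace ℝ (Fin 3)

/-- The Hilbert space `(L²(Ω))³`. -/
abbrev L2 (Ω : Set E3) : Type := Lp E3 2 (volume.restrict Ω)

/-- The partial derivative `∂φ/∂xᵢ` of a vector field. -/
def partialDeriv (i : Fin 3) (φ : E3 → E3) (x : E3) : E3 :=
  fderiv ℝ φ x (EuclideanSpace.single i 1)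

/-- The divergence of a vector field. -/
def divergence (φ : E3 → E3) (x : E3) : ℝ :=
  ∑ i : Fin 3, partialDeriv i φ x i

/-- The space `𝒱` of divergence-free fields in `(C₀^∞(Ω))³`. -/
def testFields (Ω : Set E3) : Set (E3 → E3) :=
  {φ | ContDiff ℝ ∞ φ ∧ HasCompactSupport φ ∧ tsupport φ ⊆ Ω ∧ ∀ x, divergence φ x = 0}

/-- `H`: the closure of `𝒱` in `(L²(Ω))³`, with the norm and inner product of `(L²(Ω))³`. -/
def H (Ω : Set E3) : Submodule ℝ (L2 Ω) :=
  (Submodule.span ℝ {g : L2 Ω | ∃ φ ∈ testFields Ω,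
    (g : E3 → E3) =ᵐ[volume.restrict Ω] φ}).topologicalClosure

/-- The Hilbert space of tuples `(u, (g₁, g₂, g₃))` of elements of `(L²(Ω))³`. The space
`(H¹(Ω))³` sits in it isometrically through `u ↦ (u, (∂₁u, ∂₂u, ∂₃u))`. -/
abbrev H1Ambient (Ω : Set E3) : Type :=
  WithLp 2 (L2 Ω × PiLp 2 (fun _ : Fin 3 => L2 Ω))

/-- `V`: the closure of `𝒱` in `(H₀¹(Ω))³`. An element is stored as the tuple of `u` and its
(weak) partial derivatives; convergence in the ambient space is convergence in `H¹`. -/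
def V (Ω : Set E3) : Submodule ℝ (H1Ambient Ω) :=
  (Submodule.span ℝ {z : H1Ambient Ω | ∃ φ ∈ testFields Ω,
    (z.fst : E3 → E3) =ᵐ[volume.restrict Ω] φ ∧
    ∀ i : Fin 3, (z.snd i : E3 → E3) =ᵐ[volume.restrict Ω] partialDeriv i φ}).topologicalClosure

variable {Ω : Set E3}

/-- The field `u ∈ (L²(Ω))³` underlying an element of `V`. -/
def toField (u : V Ω) : L2 Ω := (u : H1Ambient Ω).fst

/-- The partial derivatives `(∂₁u, ∂₂u, ∂₃u)` of an element of `V`. -/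
def grad (u : V Ω) : PiLp 2 (fun _ : Fin 3 => L2 Ω) := (u : H1Ambient Ω).snd

/-- The inner product `((u,v)) = ∑ᵢ ∫_Ω ∂ᵢu · ∂ᵢv dx` of `V`. -/
def innerV (u v : V Ω) : ℝ := inner ℝ (grad u) (grad v)

/-- The norm `‖u‖ = ((u,u))^{1/2}` of `V`. -/
def normV (u : V Ω) : ℝ := ‖grad u‖

/-- The trilinear form `b(u,v,w) = ∑_{i,j} ∫_Ω uᵢ (∂vⱼ/∂xᵢ) wⱼ dx`. -/
def b (u v w : V Ω) : ℝ :=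
  ∫ x in Ω, ∑ i : Fin 3, ∑ j : Fin 3,
    (toField u : E3 → E3) x i * (grad v i : E3 → E3) x j * (toField w : E3 → E3) x j

/-- The damping pairing `(|u|^{β-1} u, w) = ∫_Ω |u|^{β-1} u · w dx`. -/
def damping (β : ℝ) (u w : V Ω) : ℝ :=
  ∫ x in Ω, ‖(toField u : E3 → E3) x‖ ^ (β - 1) *
    inner ℝ ((toField u : E3 → E3) x) ((toField w : E3 → E3) x)

/-- The cutoff `F_N(r) = min(1, N/r)` for `r ≥ 0`, with `F_N(0) = 1`. -/
def cutoff (N r : ℝ) : ℝ := if r = 0 then 1 else min 1 (N / r)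

/-- The modified trilinear form `b_N(u,v,w) = F_N(‖v‖) b(u,v,w)`. -/
def bN (N : ℝ) (u v w : V Ω) : ℝ := cutoff N (normV v) * b u v w

/-- Membership of `g` in `L^q(τ,T;(L^q(Ω))³)`, for `1 ≤ q < ∞`. It is applied to functions that
are strongly measurable in time with values in `(L²(Ω))³`, so measurability in time is not
repeated. -/
def MemLqLq (Ω : Set E3) (τ T q : ℝ) (g : ℝ → E3 → E3) : Prop :=
  (∀ᵐ t ∂volume.restrict (Ioo τ T), MemLp (g t) (ENNReal.ofReal q) (volume.restrict Ω)) ∧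
  ∫⁻ t in Ioo τ T, eLpNorm (g t) (ENNReal.ofReal q) (volume.restrict Ω) ^ q < ⊤

/-- `u ∈ C([τ,T]; H_w)`: continuity in time for the weak topology of `H`. -/
def WeaklyContinuousOn (u : ℝ → H Ω) (s : Set ℝ) : Prop :=
  ∀ h : H Ω, ContinuousOn (fun t => inner ℝ (u t) h) s

/-- `u(τ) = u_τ`, where `u` is identified up to null sets of times in `(τ,T)` and its value at
`τ` is that of its representative in `C([τ,T]; H_w)`. -/
def HasInitialValue (τ T : ℝ) (u : ℝ → H Ω) (uτ : H Ω) : Prop :=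
  ∃ u' : ℝ → H Ω, WeaklyContinuousOn u' (Icc τ T) ∧
    (∀ᵐ t ∂volume.restrict (Ioo τ T), u' t = u t) ∧ u' τ = uτ

/-- `U ∈ L²(τ,T;V)` is the function `u`, regarded as taking values in `V` for a.e. time. -/
def IsL2VVersion (τ T : ℝ) (u : ℝ → H Ω) (U : ℝ → V Ω) : Prop :=
  MemLp U 2 (volume.restrict (Ioo τ T)) ∧
  ∀ᵐ t ∂volume.restrict (Ioo τ T), toField (U t) = (u t : L2 Ω)

/-- The equation
`d/dt (u,w) + μ((u,w)) + b_N(u,u,w) + α F_N(‖u‖^{β-1}) (|u|^{β-1}u, w) = (f,w)`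
in the sense of scalar distributions on `(τ,T)`, for every `w ∈ V ∩ (L^{β+1}(Ω))³`. -/
def SatisfiesEquation (μ α β N τ T : ℝ) (f u : ℝ → H Ω) (U : ℝ → V Ω) : Prop :=
  ∀ w : V Ω, MemLp (toField w : E3 → E3) (ENNReal.ofReal (β + 1)) (volume.restrict Ω) →
    ∀ φ : ℝ → ℝ, ContDiff ℝ ∞ φ → HasCompactSupport φ → tsupport φ ⊆ Ioo τ T →
      -(∫ t in Ioo τ T, inner ℝ (u t : L2 Ω) (toField w) * deriv φ t)
        + ∫ t in Ioo τ T, (μ * innerV (U t) w + bN N (U t) (U t) w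
            + α * (cutoff N (normV (U t) ^ (β - 1)) * damping β (U t) w)) * φ t
      = ∫ t in Ioo τ T, inner ℝ (f t : L2 Ω) (toField w) * φ t

/-- Weak solutions on `[τ,T]` of the globally modified Navier–Stokes equations with damping,
with `f ∈ L²(τ,T;H)` and initial value `u_τ ∈ H`. -/
def IsWeakSolution (μ α β N τ T : ℝ) (f : ℝ → H Ω) (uτ : H Ω) (u : ℝ → H Ω) : Prop :=
  MemLp u ⊤ (volume.restrict (Ioo τ T)) ∧
  HasInitialValue τ T u uτ ∧
  ∃ U : ℝ → V Ω, IsL2VVersion τ T u U ∧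
    MemLqLq Ω τ T (β + 1) (fun t x =>
      cutoff N (normV (U t) ^ (β - 1)) • (toField (U t) : E3 → E3) x) ∧
    SatisfiesEquation μ α β N τ T f u U

/-- Global weak solutions: weak solutions on `[τ,T]` for every `T > τ`. -/
def IsGlobalWeakSolution (μ α β N τ : ℝ) (f : ℝ → H Ω) (uτ : H Ω) (u : ℝ → H Ω) : Prop :=
  ∀ T, τ < T → IsWeakSolution μ α β N τ T f uτ u

end GMNSED

end

/-!
The cutoffs make both nonlinearities Lipschitz on the `L²`-bounded subsets of `V`: the convection
term maps `V` to the dual of `L³`, the damping term maps `V` to `L²`, and in both cases the decay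
of the cutoff compensates the growth in `‖u‖`. So neither the cancellation `b(v, w, w) = 0` nor the
monotonicity of the damping is needed. For the difference `w` of two solutions, the interpolation
`‖w‖²_{L³} ≤ ‖w‖_{L²} ‖w‖_{L⁶}`, the Sobolev inequality and Young's inequality absorb the
nonlinear error into `μ ‖w‖²` up to a multiple of `‖w‖²_{L²}`. Since the equation puts `w'` in
`L²(τ, T; V')`, the energy identity for `w` holds, and Grönwall's inequality gives `w = 0`.
-/

namespace GMNSED

theorem ae_eq_zero_of_le_mul_integral {a b C : ℝ} {y : ℝ → ℝ} (hy : Integrable y)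
    (hy0 : ∀ t, 0 ≤ y t) (h : ∀ᵐ t, t ∈ Ioo a b → y t ≤ C * ∫ s in a..t, y s) :
    ∀ᵐ t, t ∈ Ioo a b → y t = 0 := by
  set Y : ℝ → ℝ := fun t => ∫ s in a..t, y s
  set Z : ℝ → ℝ := fun t => ∫ s in a..t, Y s
  have hY : Continuous Y := hy.continuous_primitive a
  have hZ (t : ℝ) : HasDerivAt Z (Y t) t :=
    intervalIntegral.integral_hasDerivAt_right (hY.intervalIntegrable _ _)
      (hY.stronglyMeasurableAtFilter _ _) hY.continuousAt
  have hY0 {t : ℝ} (ht : a ≤ t) : 0 ≤ Y t := intervalIntegral.integral_nonneg ht fun s _ => hy0 s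
  have hZ0 {t : ℝ} (ht : a ≤ t) : 0 ≤ Z t :=
    intervalIntegral.integral_nonneg ht fun s hs => hY0 hs.1
  have hYZ {t : ℝ} (ht : t ∈ Icc a b) : Y t ≤ C * Z t := by
    rw [← intervalIntegral.integral_const_mul]
    refine intervalIntegral.integral_mono_ae_restrict ht.1 hy.intervalIntegrable
      ((hY.const_mul C).intervalIntegrable _ _) ?_
    rw [← restrict_Ioo_eq_restrict_Icc]
    exact ae_restrict_of_ae_restrict_of_subset (Ioo_subset_Ioo_right ht.2)
      ((ae_restrict_iff' measurableSet_Ioo).2 h)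
  have hZz : ∀ t ∈ Icc a b, Z t = 0 := by
    refine eq_zero_of_abs_deriv_le_mul_abs_self_of_eq_zero_right (f' := Y) (K := C)
      (fun t _ => (hZ t).continuousAt.continuousWithinAt) (fun t _ => (hZ t).hasDerivWithinAt)
      intervalIntegral.integral_same fun t ht => ?_
    rw [Real.norm_of_nonneg (hY0 ht.1), Real.norm_of_nonneg (hZ0 ht.1)]
    exact hYZ (Ico_subset_Icc_self ht)
  filter_upwards [h] with t ht hmem
  have hmem' : t ∈ Icc a b := Ioo_subset_Icc_self hmem
  have hYz : Y t = 0 := le_antisymm (by simpa [hZz t hmem'] using hYZ hmem') (hY0 hmem'.1)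
  exact le_antisymm (by simpa [hYz] using show y t ≤ C * Y t from ht hmem) (hy0 t)

/-- Test functions on an open set `s` of times: elements of `C_c^∞(s)`. -/
structure IsTestFunction (s : Set ℝ) (φ : ℝ → ℝ) : Prop where
  contDiff : ContDiff ℝ ∞ φ
  hasCompactSupport : HasCompactSupport φ
  tsupport_subset : tsupport φ ⊆ s

/-- `g` is the derivative of `c` in the sense of distributions on the open set `s`. -/
def HasDistribDerivOn (c g : ℝ → ℝ) (s : Set ℝ) : Prop :=
  ∀ φ : ℝ → ℝ, IsTestFunction s φ → -∫ t in s, c t * deriv φ t = ∫ t in s, g t * φ t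

namespace IsTestFunction

variable {a b : ℝ} {s : Set ℝ} {φ ψ : ℝ → ℝ}

theorem eq_zero_of_notMem (hφ : IsTestFunction s φ) {t : ℝ} (ht : t ∉ s) : φ t = 0 :=
  image_eq_zero_of_notMem_tsupport fun h => ht (hφ.tsupport_subset h)

theorem sub_const_mul (hφ : IsTestFunction s φ) (hψ : IsTestFunction s ψ) (c : ℝ) :
    IsTestFunction s fun t => φ t - c * ψ t where
  contDiff := hφ.contDiff.sub (contDiff_const.mul hψ.contDiff)
  hasCompactSupport := hφ.hasCompactSupport.sub hψ.hasCompactSupport.mul_left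
  tsupport_subset := (tsupport_sub φ fun t => c * ψ t).trans <| union_subset hφ.tsupport_subset <|
    (closure_mono (Function.support_mul_subset_right _ _)).trans hψ.tsupport_subset

theorem continuous_deriv (hφ : IsTestFunction s φ) : Continuous (deriv φ) :=
  hφ.contDiff.continuous_deriv (by simp)

theorem integrable (hφ : IsTestFunction s φ) : Integrable φ :=
  hφ.contDiff.continuous.integrable_of_hasCompactSupport hφ.hasCompactSupport

theorem setIntegral_mul (hφ : IsTestFunction s φ) (q : ℝ → ℝ) :
    ∫ t in s, q t * φ t = ∫ t, q t * φ t :=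
  setIntegral_eq_integral_of_forall_compl_eq_zero fun t ht => by simp [hφ.eq_zero_of_notMem ht]

theorem integrableOn_mul (hφ : IsTestFunction s φ) {q : ℝ → ℝ} (hq : IntegrableOn q s) :
    IntegrableOn (fun t => q t * φ t) s := by
  obtain ⟨B, hB⟩ := hφ.hasCompactSupport.exists_bound_of_continuous hφ.contDiff.continuous
  exact hq.mul_bdd hφ.contDiff.continuous.aestronglyMeasurable (Eventually.of_forall hB)

theorem integrableOn_mul_deriv (hφ : IsTestFunction s φ) {q : ℝ → ℝ} (hq : IntegrableOn q s) :
    IntegrableOn (fun t => q t * deriv φ t) s := by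
  obtain ⟨B, hB⟩ := hφ.hasCompactSupport.deriv.exists_bound_of_continuous hφ.continuous_deriv
  exact hq.mul_bdd hφ.continuous_deriv.aestronglyMeasurable (Eventually.of_forall hB)

theorem absolutelyContinuousOnInterval (hφ : IsTestFunction s φ) (a b : ℝ) :
    AbsolutelyContinuousOnInterval φ a b :=
  have ⟨_, hK⟩ := (hφ.contDiff.of_le (m := 1) (by norm_num)).lipschitzWith_of_hasCompactSupport
    hφ.hasCompactSupport (by norm_num)
  hK.lipschitzOnWith.absolutelyContinuousOnInterval

theorem exists_primitive (hψ : IsTestFunction (Ioo a b) ψ) (h0 : ∫ t, ψ t = 0) :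
    ∃ φ : ℝ → ℝ, IsTestFunction (Ioo a b) φ ∧ deriv φ = ψ := by
  rcases (tsupport ψ).eq_empty_or_nonempty with hempty | hne
  · rw [tsupport_eq_empty_iff] at hempty
    exact ⟨0, ⟨contDiff_const, HasCompactSupport.zero, by simp⟩, by simp [hempty]⟩
  obtain ⟨m, hm, hleast⟩ := hψ.hasCompactSupport.isCompact.exists_isLeast hne
  obtain ⟨M, hM, hgreatest⟩ := hψ.hasCompactSupport.isCompact.exists_isGreatest hne
  set φ : ℝ → ℝ := fun t => ∫ s in a..t, ψ s
  have hψc : Continuous ψ := hψ.contDiff.continuous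
  have hφ (t : ℝ) : HasDerivAt φ (ψ t) t :=
    intervalIntegral.integral_hasDerivAt_right (hψc.intervalIntegrable _ _)
      (hψc.stronglyMeasurableAtFilter _ _) hψc.continuousAt
  have hderiv : deriv φ = ψ := funext fun t => (hφ t).deriv
  have hsupp : Function.support φ ⊆ Icc m M := by
    intro t ht
    by_contra hnot
    refine ht ?_
    rcases not_and_or.1 hnot with hlt | hgt
    · refine (intervalIntegral.integral_congr fun s hs => ?_).trans intervalIntegral.integral_zero
      have hsm : s < m := hs.2.trans_lt (max_lt (hψ.tsupport_subset hm).1 (not_le.1 hlt))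
      exact image_eq_zero_of_notMem_tsupport fun h => hsm.not_ge (hleast h)
    · refine (intervalIntegral.integral_eq_integral_of_support_subset fun s hs => ?_).trans h0
      have hs' := subset_tsupport ψ hs
      exact ⟨(hψ.tsupport_subset hs').1, (hgreatest hs').trans (not_le.1 hgt).le⟩
  refine ⟨φ, ⟨?_, HasCompactSupport.of_support_subset_isCompact isCompact_Icc hsupp, ?_⟩, hderiv⟩
  · rw [contDiff_infty_iff_deriv, hderiv]
    exact ⟨fun t => (hφ t).differentiableAt, hψ.contDiff⟩
  · exact (closure_minimal hsupp isClosed_Icc).trans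
      (Icc_subset_Ioo (hψ.tsupport_subset hm).1 (hψ.tsupport_subset hM).2)

theorem exists_integral_pos (hab : a < b) :
    ∃ ρ : ℝ → ℝ, IsTestFunction (Ioo a b) ρ ∧ 0 < ∫ t, ρ t := by
  obtain ⟨ρ, hsupp, hcomp, hsmooth, hrange, hone⟩ := exists_contDiff_tsupport_subset (n := ⊤)
    (isOpen_Ioo.mem_nhds (show (a + b) / 2 ∈ Ioo a b by constructor <;> linarith))
  exact ⟨ρ, ⟨hsmooth, hcomp, hsupp⟩,
    hsmooth.continuous.integral_pos_of_hasCompactSupport_nonneg_nonzero (x := (a + b) / 2) hcomp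
      (fun t => (hrange (mem_range_self t)).1) (by simp [hone])⟩

end IsTestFunction

namespace HasDistribDerivOn

variable {a b : ℝ} {s : Set ℝ} {c c' g g' : ℝ → ℝ}

theorem sub (hc : HasDistribDerivOn c g s) (hc' : HasDistribDerivOn c' g' s)
    (hci : IntegrableOn c s) (hci' : IntegrableOn c' s) (hgi : IntegrableOn g s)
    (hgi' : IntegrableOn g' s) :
    HasDistribDerivOn (fun t => c t - c' t) (fun t => g t - g' t) s := by
  intro φ hφ
  simp only [sub_mul]
  rw [integral_sub (hφ.integrableOn_mul_deriv hci) (hφ.integrableOn_mul_deriv hci'),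
    integral_sub (hφ.integrableOn_mul hgi) (hφ.integrableOn_mul hgi'), ← hc φ hφ, ← hc' φ hφ]
  ring

/-- Du Bois-Reymond: subtracting a multiple of a fixed bump turns a test function into the
derivative of one, so that only the total integral of the test function survives. -/
theorem ae_eq_const (hab : a < b) (hc : HasDistribDerivOn c 0 (Ioo a b))
    (hci : IntegrableOn c (Ioo a b)) : ∃ K, ∀ᵐ t, t ∈ Ioo a b → c t = K := by
  obtain ⟨ρ, hρ, hρpos⟩ := IsTestFunction.exists_integral_pos hab
  set K : ℝ := (∫ t in Ioo a b, c t * ρ t) / ∫ t, ρ t with hK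
  suffices hzero : ∀ᵐ t, t ∈ Ioo a b → c t - K = 0 by
    exact ⟨K, hzero.mono fun t ht hmem => sub_eq_zero.1 (ht hmem)⟩
  refine isOpen_Ioo.ae_eq_zero_of_integral_contDiff_smul_eq_zero
    (hci.sub (integrableOn_const (by simp))).locallyIntegrableOn fun ψ hsmooth hcomp hsupp => ?_
  have hψ : IsTestFunction (Ioo a b) ψ := ⟨hsmooth, hcomp, hsupp⟩
  set I : ℝ := (∫ t, ψ t) / ∫ t, ρ t with hI
  have hmean : ∫ t, (ψ t - I * ρ t) = 0 := by
    rw [integral_sub hψ.integrable (hρ.integrable.const_mul I), integral_const_mul, hI]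
    field_simp
    ring
  obtain ⟨φ, hφ, hderiv⟩ := (hψ.sub_const_mul hρ I).exists_primitive hmean
  have hcψ : ∫ t in Ioo a b, c t * ψ t = I * ∫ t in Ioo a b, c t * ρ t := by
    have hzero := hc φ hφ
    simp only [hderiv, mul_sub, mul_left_comm _ I, Pi.zero_apply, zero_mul,
      integral_zero, neg_eq_zero] at hzero
    rwa [integral_sub (hψ.integrableOn_mul hci) ((hρ.integrableOn_mul hci).const_mul I),
      integral_const_mul, sub_eq_zero] at hzero
  calc ∫ t, ψ t • (c t - K) = ∫ t in Ioo a b, (c t * ψ t - K * ψ t) := by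
        simp only [← sub_mul]
        rw [hψ.setIntegral_mul fun t => c t - K]
        simp only [smul_eq_mul, mul_comm]
    _ = I * (∫ t in Ioo a b, c t * ρ t) - K * ∫ t, ψ t := by
        rw [integral_sub (hψ.integrableOn_mul hci) (hψ.integrable.integrableOn.const_mul K),
          hcψ, hψ.setIntegral_mul (fun _ => K), integral_const_mul]
    _ = 0 := by rw [hI, hK]; ring

theorem integral (hab : a ≤ b) (hg : IntegrableOn g (Ioo a b)) :
    HasDistribDerivOn (fun t => ∫ s in a..t, g s) g (Ioo a b) := by
  intro φ hφ
  have hgI : IntervalIntegrable g volume a b :=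
    (intervalIntegrable_iff_integrableOn_Ioo_of_le hab).2 hg
  have hparts := (hgI.absolutelyContinuousOnInterval_intervalIntegral
    left_mem_uIcc).integral_mul_deriv_eq_deriv_mul (hφ.absolutelyContinuousOnInterval a b)
  have hderiv : ∫ t in a..b, deriv (fun t => ∫ s in a..t, g s) t * φ t =
      ∫ t in a..b, g t * φ t := by
    refine intervalIntegral.integral_congr_ae ?_
    filter_upwards [hgI.ae_hasDerivAt_integral] with t ht hmem
    rw [(ht (uIoc_subset_uIcc hmem) a left_mem_uIcc).deriv]
  rw [hφ.eq_zero_of_notMem (t := a) (by simp), hφ.eq_zero_of_notMem (t := b) (by simp), hderiv,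
    mul_zero, mul_zero, sub_zero, zero_sub] at hparts
  rw [← integral_Ioc_eq_integral_Ioo, ← integral_Ioc_eq_integral_Ioo,
    ← intervalIntegral.integral_of_le hab, ← intervalIntegral.integral_of_le hab, hparts, neg_neg]

theorem eq_integral (hab : a < b) (h : HasDistribDerivOn c g (Ioo a b))
    (hc : ContinuousOn c (Icc a b)) (hca : c a = 0) (hg : IntegrableOn g (Ioo a b)) :
    ∀ t ∈ Icc a b, c t = ∫ s in a..t, g s := by
  have hgI : IntervalIntegrable g volume a b :=
    (intervalIntegrable_iff_integrableOn_Ioo_of_le hab.le).2 hg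
  have hP : ContinuousOn (fun t => ∫ s in a..t, g s) (Icc a b) := by
    simpa only [uIcc_of_le hab.le] using
      (hgI.absolutelyContinuousOnInterval_intervalIntegral left_mem_uIcc).continuousOn
  have hci : IntegrableOn c (Ioo a b) := hc.integrableOn_Icc.mono_set Ioo_subset_Icc_self
  have hPi : IntegrableOn (fun t => ∫ s in a..t, g s) (Ioo a b) :=
    hP.integrableOn_Icc.mono_set Ioo_subset_Icc_self
  have hsub : HasDistribDerivOn (fun t => c t - ∫ s in a..t, g s) 0 (Ioo a b) := by
    have hdiff := h.sub (integral hab.le hg) hci hPi hg hg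
    simp only [sub_self] at hdiff
    exact hdiff
  obtain ⟨K, hK⟩ := hsub.ae_eq_const hab (hci.sub hPi)
  have heq : EqOn (fun t => c t - ∫ s in a..t, g s) (fun _ => K) (Icc a b) := by
    refine Measure.eqOn_Icc_of_ae_eq volume hab.ne ?_ (hc.sub hP) continuousOn_const
    rw [← restrict_Ioo_eq_restrict_Icc]
    exact (ae_restrict_iff' measurableSet_Ioo).2 hK
  have hK0 : K = 0 := by simpa [hca] using (heq (left_mem_Icc.2 hab.le)).symm
  exact fun t ht => sub_eq_zero.1 ((heq ht).trans hK0)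

end HasDistribDerivOn

theorem tendsto_inv_mul_intervalIntegral {Φ : ℝ × ℝ → ℝ} (hΦ : Continuous Φ) :
    Tendsto (fun h => h⁻¹ * ∫ k in (0)..h, Φ (k, h)) (𝓝[≠] 0) (𝓝 (Φ 0)) := by
  have hcont : Continuous fun h : ℝ => ∫ s in (0)..1, Φ (h * s, h) :=
    intervalIntegral.continuous_parametric_intervalIntegral_of_continuous' (by fun_prop) 0 1
  have hlim : Tendsto (fun h : ℝ => ∫ s in (0)..1, Φ (h * s, h)) (𝓝[≠] 0) (𝓝 (Φ 0)) := by
    have hzero := (hcont.tendsto 0).mono_left (nhdsWithin_le_nhds (s := {0}ᶜ))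
    simpa [Prod.mk_zero_zero] using hzero
  refine hlim.congr' ?_
  filter_upwards [self_mem_nhdsWithin] with h hh
  simp [intervalIntegral.integral_comp_mul_left (fun k => Φ (k, h)) hh]

section Energy

variable {X Y : Type*} [NormedAddCommGroup X] [NormedSpace ℝ X]
  [NormedAddCommGroup Y] [InnerProductSpace ℝ Y]
  {G : ℝ → StrongDual ℝ X} {W Z : ℝ → X}

theorem coeFn_vadd_toLp {E : Type*} [NormedAddCommGroup E] {p : ℝ≥0∞} {g : ℝ → E}
    (hg : MemLp g p volume) (k : ℝ) :
    (DomAddAct.mk k +ᵥ hg.toLp g : Lp E p (volume : Measure ℝ)) =ᵐ[volume] fun r => g (r + k) := by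
  rw [DomAddAct.mk_vadd_toLp]
  refine (MemLp.coeFn_toLp _).trans (Eventually.of_forall fun r => ?_)
  simp [add_comm]

theorem continuous_integral_translate_apply (hG : MemLp G 2) (hW : MemLp W 2) (s : Set ℝ) :
    Continuous fun p : ℝ × ℝ => ∫ r in s, G (r + p.1) (W (r + p.2)) := by
  have : Fact ((2 : ℝ≥0∞) ≠ ⊤) := ⟨by simp⟩
  let pairing := (ContinuousLinearMap.id ℝ (StrongDual ℝ X)).lpPairing (volume.restrict s) 2 2
  let restrG := LpToLpRestrictCLM ℝ (StrongDual ℝ X) ℝ volume 2 s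
  let restrW := LpToLpRestrictCLM ℝ X ℝ volume 2 s
  have hpairing (p : ℝ × ℝ) : ∫ r in s, G (r + p.1) (W (r + p.2)) =
      pairing (restrG (DomAddAct.mk p.1 +ᵥ hG.toLp G))
        (restrW (DomAddAct.mk p.2 +ᵥ hW.toLp W)) := by
    rw [ContinuousLinearMap.lpPairing_eq_integral]
    refine integral_congr_ae ?_
    filter_upwards [LpToLpRestrictCLM_coeFn ℝ s (DomAddAct.mk p.1 +ᵥ hG.toLp G),
      LpToLpRestrictCLM_coeFn ℝ s (DomAddAct.mk p.2 +ᵥ hW.toLp W),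
      ae_restrict_of_ae (coeFn_vadd_toLp hG p.1), ae_restrict_of_ae (coeFn_vadd_toLp hW p.2)]
      with r hrG hrW hkG hkW
    simp only [restrG, restrW, ContinuousLinearMap.coe_id', id_eq, hrG, hrW, hkG, hkW]
  simp_rw [hpairing]
  have hmk : Continuous fun k : ℝ => (DomAddAct.mk k : ℝᵈᵃᵃ) := DomAddAct.continuous_mk
  exact (pairing.continuous.comp
    (restrG.continuous.comp ((hmk.comp continuous_fst).vadd continuous_const))).clm_apply
    (restrW.continuous.comp ((hmk.comp continuous_snd).vadd continuous_const))

theorem integrable_dual_apply {α : Type*} [MeasurableSpace α] {ν : Measure α}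
    {G : α → StrongDual ℝ X} {Z : α → X} (hG : MemLp G 2 ν) (hZ : MemLp Z 2 ν) :
    Integrable (fun r => G r (Z r)) ν :=
  (hG.norm.integrable_mul hZ.norm).mono'
    ((ContinuousLinearMap.id ℝ (StrongDual ℝ X)).aestronglyMeasurable_comp₂ hG.1 hZ.1)
    (Eventually.of_forall fun r => (G r).le_opNorm (Z r))

theorem memLp_comp_add_prod {E : Type*} [NormedAddCommGroup E] {g : ℝ → E} (hg : MemLp g 2)
    (ν : Measure ℝ) [IsFiniteMeasure ν] (hν : ν ≪ volume) :
    MemLp (fun p : ℝ × ℝ => g (p.1 + p.2)) 2 ((volume : Measure ℝ).prod ν) := by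
  have hmp : Measure.QuasiMeasurePreserving (fun p : ℝ × ℝ => p.1 + p.2)
      ((volume : Measure ℝ).prod ν) volume :=
    (quasiMeasurePreserving_add volume (volume : Measure ℝ)).mono_left
      (Measure.AbsolutelyContinuous.rfl.prod hν)
  have hmeas := hg.1.comp_quasiMeasurePreserving hmp
  refine (memLp_two_iff_integrable_sq_norm hmeas).2 ((integrable_prod_iff' (hmeas.norm.pow 2)).2
    ⟨Eventually.of_forall fun k => (hg.integrable_norm_pow (by simp)).comp_add_right k, ?_⟩)
  have htranslate (k : ℝ) : ∫ r, ‖‖g (r + k)‖ ^ 2‖ = ∫ r, ‖‖g r‖ ^ 2‖ :=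
    integral_add_right_eq_self (fun r => ‖‖g r‖ ^ 2‖) k
  exact (integrable_const _).congr (Eventually.of_forall fun k => (htranslate k).symm)

theorem integrable_translate_apply (hG : MemLp G 2) (hZ : MemLp Z 2) (s : Set ℝ) (h : ℝ) :
    Integrable (fun p : ℝ × ℝ => G (p.1 + p.2) (Z p.1))
      ((volume.restrict s).prod (volume.restrict (Ioc 0 h))) :=
  (integrable_dual_apply
    (memLp_comp_add_prod hG _ Measure.restrict_le_self.absolutelyContinuous)
    (hZ.comp_fst _)).mono_measure (Measure.prod_mono Measure.restrict_le_self le_rfl)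

/-- The increment of `‖w‖²` over `[r, r + h]` is `∫ ⟨G, W(r + h) + W(r)⟩` over that interval, by
polarization; integrating in `r` up to `t` telescopes the left-hand side. -/
theorem integral_norm_sq_eq_integral_translate (j : X →L[ℝ] Y) {w : ℝ → Y} {t h T : ℝ}
    (hG : MemLp G 2) (hW : MemLp W 2) (hw : ∀ᵐ t, t < T → w t = j (W t))
    (hder : ∀ s t, s ≤ t → t < T → ∀ z, inner ℝ (w t - w s) (j z) = ∫ r in s..t, G r z)
    (h0 : 0 ≤ h) (hT : t + h < T) :
    ∫ r in t..t + h, ‖j (W r)‖ ^ 2 =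
      ∫ k in (0)..h, ∫ r in Iic t, G (r + k) (W (r + h) + W r) := by
  have hWh : MemLp (fun r => W (r + h)) 2 :=
    hW.comp_measurePreserving (measurePreserving_add_right volume h)
  have hsq : Integrable fun r => ‖j (W r)‖ ^ 2 := (j.comp_memLp' hW).integrable_norm_pow (by simp)
  have hincr : ∀ᵐ r, r ∈ Iic t → ∫ k in Ioc 0 h, G (r + k) (W (r + h) + W r) =
      ‖j (W (r + h))‖ ^ 2 - ‖j (W r)‖ ^ 2 := by
    filter_upwards [hw, (measurePreserving_add_right volume h).quasiMeasurePreserving.ae hw]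
      with r hwr hwrh hr
    have hrh : r + h < T := (add_le_add_left (mem_Iic.1 hr) h).trans_lt hT
    rw [← intervalIntegral.integral_of_le h0,
      intervalIntegral.integral_comp_add_left (fun k => G k (W (r + h) + W r)) r, add_zero,
      ← hder r (r + h) (le_add_of_nonneg_right h0) hrh, hwrh hrh,
      hwr ((le_add_of_nonneg_right h0).trans_lt hrh), map_add, add_comm (j (W (r + h)))]
    rw [inner_sub_left, inner_add_right, inner_add_right, real_inner_comm,
      real_inner_self_eq_norm_sq, real_inner_self_eq_norm_sq]
    ring
  have hshift : ∫ r in Iic t, ‖j (W (r + h))‖ ^ 2 = ∫ r in Iic (t + h), ‖j (W r)‖ ^ 2 := by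
    rw [← (measurePreserving_add_right volume h).setIntegral_preimage_emb
      (measurableEmbedding_addRight h) (fun r => ‖j (W r)‖ ^ 2) (Iic (t + h))]
    simp
  rw [intervalIntegral.integral_of_le h0,
    ← integral_integral_swap (integrable_translate_apply hG (hWh.add hW) (Iic t) h)]
  rw [setIntegral_congr_ae measurableSet_Iic hincr,
    integral_sub (hsq.comp_add_right h).integrableOn hsq.integrableOn, hshift,
    intervalIntegral.integral_Iic_sub_Iic hsq.integrableOn hsq.integrableOn]

theorem ae_norm_sq_eq_two_mul_integral (j : X →L[ℝ] Y) {w : ℝ → Y} {T : ℝ}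
    (hG : MemLp G 2) (hW : MemLp W 2) (hw : ∀ᵐ t, t < T → w t = j (W t))
    (hder : ∀ s t, s ≤ t → t < T → ∀ z, inner ℝ (w t - w s) (j z) = ∫ r in s..t, G r z) :
    ∀ᵐ t, t < T → ‖j (W t)‖ ^ 2 = 2 * ∫ r in Iic t, G r (W r) := by
  have hsq : Integrable fun r => ‖j (W r)‖ ^ 2 := (j.comp_memLp' hW).integrable_norm_pow (by simp)
  filter_upwards [LocallyIntegrable.ae_hasDerivAt_integral hsq.locallyIntegrable] with t hdiff htT
  set Φ : ℝ × ℝ → ℝ := fun p =>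
    (∫ r in Iic t, G (r + p.1) (W (r + p.2))) + ∫ r in Iic t, G (r + p.1) (W (r + 0)) with hΦ
  have hpair := continuous_integral_translate_apply hG hW (Iic t)
  have hΦc : Continuous Φ :=
    hpair.add (hpair.comp (show Continuous fun p : ℝ × ℝ => (p.1, (0 : ℝ)) by fun_prop))
  have hΦ0 : Φ 0 = 2 * ∫ r in Iic t, G r (W r) := by simp [hΦ, two_mul]
  have htrans {g : ℝ → StrongDual ℝ X} (hg : MemLp g 2) (k : ℝ) : MemLp (fun r => g (r + k)) 2 :=
    hg.comp_measurePreserving (measurePreserving_add_right volume k)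
  have hWtrans (k : ℝ) : MemLp (fun r => W (r + k)) 2 :=
    hW.comp_measurePreserving (measurePreserving_add_right volume k)
  have hincr : ∀ᶠ h in 𝓝[>] (0 : ℝ),
      h⁻¹ * ∫ k in (0)..h, Φ (k, h) = h⁻¹ * ∫ r in t..t + h, ‖j (W r)‖ ^ 2 := by
    filter_upwards [Ioo_mem_nhdsGT (sub_pos.2 htT)] with h hh
    rw [integral_norm_sq_eq_integral_translate j hG hW hw hder hh.1.le (by linarith [hh.2])]
    congr 2 with k
    simp only [hΦ, map_add, add_zero]
    rw [integral_add (integrable_dual_apply (htrans hG k) (hWtrans h)).integrableOn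
      (integrable_dual_apply (htrans hG k) hW).integrableOn]
  have hslope : Tendsto (fun h : ℝ => h⁻¹ * ∫ r in t..t + h, ‖j (W r)‖ ^ 2) (𝓝[>] 0)
      (𝓝 (‖j (W t)‖ ^ 2)) := by
    simpa using (hdiff t).tendsto_slope_zero_right
  rw [← hΦ0]
  exact tendsto_nhds_unique hslope (((tendsto_inv_mul_intervalIntegral hΦc).mono_left
    (nhdsWithin_mono 0 fun _ => ne_of_gt)).congr' hincr)

end Energy

section Uniqueness

variable {X Y : Type*} [NormedAddCommGroup X] [NormedSpace ℝ X]
  [NormedAddCommGroup Y] [InnerProductSpace ℝ Y]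
  {G : ℝ → StrongDual ℝ X} {W : ℝ → X} {w : ℝ → Y} {τ T C : ℝ}

theorem ae_eq_zero_of_dual_apply_le (j : X →L[ℝ] Y) (hG : MemLp G 2) (hW : MemLp W 2)
    (hw : ∀ᵐ t, t < T → w t = j (W t))
    (hder : ∀ s t, s ≤ t → t < T → ∀ z, inner ℝ (w t - w s) (j z) = ∫ r in s..t, G r z)
    (hWτ : ∀ t ≤ τ, W t = 0) (hGW : ∀ᵐ t, G t (W t) ≤ C * ‖j (W t)‖ ^ 2) :
    ∀ᵐ t, t ∈ Ioo τ T → w t = 0 := by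
  set y : ℝ → ℝ := fun t => ‖j (W t)‖ ^ 2
  have hy : Integrable y := (j.comp_memLp' hW).integrable_norm_pow (by simp)
  have hpast : ∫ t in Iic τ, y t = 0 :=
    setIntegral_eq_zero_of_forall_eq_zero fun t ht => by simp [y, hWτ t ht]
  have hgronwall : ∀ᵐ t, t ∈ Ioo τ T → y t ≤ 2 * C * ∫ s in τ..t, y s := by
    filter_upwards [ae_norm_sq_eq_two_mul_integral j hG hW hw hder] with t henergy ht
    calc y t = 2 * ∫ r in Iic t, G r (W r) := henergy ht.2
      _ ≤ 2 * ∫ r in Iic t, C * y r := by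
          gcongr 2 * ?_
          exact integral_mono_ae (integrable_dual_apply hG hW).integrableOn
            (hy.const_mul C).integrableOn (ae_restrict_of_ae hGW)
      _ = 2 * C * ∫ s in τ..t, y s := by
          rw [← intervalIntegral.integral_Iic_sub_Iic hy.integrableOn hy.integrableOn, hpast,
            integral_const_mul]
          ring
  filter_upwards [hw, ae_eq_zero_of_le_mul_integral hy (fun _ => by positivity) hgronwall]
    with t hwt hyt ht
  rw [hwt ht.2]
  exact norm_eq_zero.1 (pow_eq_zero_iff two_ne_zero |>.1 (hyt ht))

theorem inner_indicator_eq_integral (j : X →L[ℝ] Y) (hτT : τ < T)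
    (hG : MemLp G 2 (volume.restrict (Ioo τ T)))
    (hwc : ∀ z, ContinuousOn (fun t => inner ℝ (w t) (j z)) (Icc τ T)) (hw0 : w τ = 0)
    (hder : ∀ z, HasDistribDerivOn (fun t => inner ℝ (w t) (j z)) (fun t => G t z) (Ioo τ T))
    (z : X) {t : ℝ} (ht : t < T) :
    inner ℝ ((Ioi τ).indicator w t) (j z) = ∫ r in τ..t, (Ioo τ T).indicator G r z := by
  rcases le_or_gt t τ with hle | hlt
  · rw [indicator_of_notMem (notMem_Ioi.2 hle), inner_zero_left, intervalIntegral.integral_symm,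
      intervalIntegral.integral_of_le hle, setIntegral_eq_zero_of_forall_eq_zero, neg_zero]
    intro r hr
    rw [indicator_of_notMem fun h => h.1.not_ge hr.2, zero_apply]
  · rw [indicator_of_mem (mem_Ioi.2 hlt), (hder z).eq_integral hτT (hwc z) (by simp [hw0])
      ((hG.integrable one_le_two).apply_continuousLinearMap z) t ⟨hlt.le, ht.le⟩]
    refine intervalIntegral.integral_congr_ae (Eventually.of_forall fun r hr => ?_)
    rw [uIoc_of_le hlt.le] at hr
    rw [indicator_of_mem (show r ∈ Ioo τ T from ⟨hr.1, hr.2.trans_lt ht⟩)]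

/-- Extending `w`, `W` and `G` by zero to earlier times preserves `w' = G` because `w τ = 0`. -/
theorem ae_eq_zero_of_hasDistribDerivOn (j : X →L[ℝ] Y) (hτT : τ < T)
    (hG : MemLp G 2 (volume.restrict (Ioo τ T))) (hW : MemLp W 2 (volume.restrict (Ioo τ T)))
    (hwW : ∀ᵐ t ∂volume.restrict (Ioo τ T), w t = j (W t))
    (hwc : ∀ z, ContinuousOn (fun t => inner ℝ (w t) (j z)) (Icc τ T)) (hw0 : w τ = 0)
    (hder : ∀ z, HasDistribDerivOn (fun t => inner ℝ (w t) (j z)) (fun t => G t z) (Ioo τ T))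
    (hGW : ∀ᵐ t ∂volume.restrict (Ioo τ T), G t (W t) ≤ C * ‖j (W t)‖ ^ 2) :
    ∀ᵐ t ∂volume.restrict (Ioo τ T), w t = 0 := by
  rw [ae_restrict_iff' measurableSet_Ioo] at hwW hGW ⊢
  have hG' : MemLp ((Ioo τ T).indicator G) 2 :=
    (memLp_indicator_iff_restrict (ε := StrongDual ℝ X) measurableSet_Ioo).2 hG
  have hW' : MemLp ((Ioo τ T).indicator W) 2 :=
    (memLp_indicator_iff_restrict measurableSet_Ioo).2 hW
  have hw' : ∀ᵐ t, t < T → (Ioi τ).indicator w t = j ((Ioo τ T).indicator W t) := by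
    filter_upwards [hwW] with t hwt htT
    by_cases ht : τ < t
    · rw [indicator_of_mem (mem_Ioi.2 ht), indicator_of_mem (mem_Ioo.2 ⟨ht, htT⟩), hwt ⟨ht, htT⟩]
    · rw [indicator_of_notMem (notMem_Ioi.2 (not_lt.1 ht)), indicator_of_notMem fun h => ht h.1,
        map_zero]
  have hGi (z : X) (s t : ℝ) :
      IntervalIntegrable (fun r => (Ioo τ T).indicator G r z) volume s t :=
    intervalIntegrable_iff.2 <| ((hG'.locallyIntegrable one_le_two).integrableOn_isCompact
      isCompact_uIcc |>.mono_set uIoc_subset_uIcc).apply_continuousLinearMap z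
  have hder' (s t : ℝ) (hst : s ≤ t) (ht : t < T) (z : X) :
      inner ℝ ((Ioi τ).indicator w t - (Ioi τ).indicator w s) (j z) =
        ∫ r in s..t, (Ioo τ T).indicator G r z := by
    rw [inner_sub_left, inner_indicator_eq_integral j hτT hG hwc hw0 hder z ht,
      inner_indicator_eq_integral j hτT hG hwc hw0 hder z (hst.trans_lt ht),
      intervalIntegral.integral_interval_sub_left (hGi z _ _) (hGi z _ _)]
  have hGW' : ∀ᵐ t, (Ioo τ T).indicator G t ((Ioo τ T).indicator W t) ≤
      C * ‖j ((Ioo τ T).indicator W t)‖ ^ 2 := by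
    filter_upwards [hGW] with t hGt
    by_cases ht : t ∈ Ioo τ T
    · simpa only [indicator_of_mem ht] using hGt ht
    · simp [indicator_of_notMem ht]
  have hext := ae_eq_zero_of_dual_apply_le j hG' hW' hw' hder'
    (fun t ht => indicator_of_notMem (fun h => h.1.not_ge ht) W) hGW'
  filter_upwards [hext] with t hzero ht
  simpa only [indicator_of_mem (mem_Ioi.2 ht.1)] using hzero ht

end Uniqueness

section Evolution

variable {X Y : Type*} [NormedAddCommGroup X] [NormedSpace ℝ X]
  [NormedAddCommGroup Y] [InnerProductSpace ℝ Y]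
  {j : X →L[ℝ] Y} {A : X → StrongDual ℝ X} {f u v : ℝ → Y} {U U₂ : ℝ → X} {τ T : ℝ}

/-- `u` is an essentially bounded, weakly continuous solution on `[τ, T]` of the evolution equation
`u' + A u = f` tested against `X`, and `U ∈ L²(τ, T; X)` is the version of `u` to which `A` is
applied. The space `X` is mapped to the pivot space `Y` by `j`. -/
structure IsEvolutionSolution (j : X →L[ℝ] Y) (A : X → StrongDual ℝ X) (f : ℝ → Y) (τ T : ℝ)
    (u : ℝ → Y) (U : ℝ → X) : Prop where
  memLp : MemLp U 2 (volume.restrict (Ioo τ T))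
  ae_eq : ∀ᵐ t ∂volume.restrict (Ioo τ T), u t = j (U t)
  ae_bounded : ∃ S, ∀ᵐ t ∂volume.restrict (Ioo τ T), ‖u t‖ ≤ S
  continuousOn : ∀ z, ContinuousOn (fun t => inner ℝ (u t) (j z)) (Icc τ T)
  equation : ∀ z φ, IsTestFunction (Ioo τ T) φ →
    -(∫ t in Ioo τ T, inner ℝ (u t) (j z) * deriv φ t) + ∫ t in Ioo τ T, A (U t) z * φ t =
      ∫ t in Ioo τ T, inner ℝ (f t) (j z) * φ t

theorem continuous_of_lipschitzOnWith_pivot_ball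
    (hA : ∀ S, ∃ L, LipschitzOnWith L A {x | ‖j x‖ ≤ S}) : Continuous A := by
  refine continuous_iff_continuousAt.2 fun x => ?_
  obtain ⟨L, hL⟩ := hA (‖j x‖ + 1)
  exact hL.continuousOn.continuousAt <| mem_of_superset
    ((isOpen_lt j.continuous.norm continuous_const).mem_nhds (lt_add_one ‖j x‖))
    (ofPred_subset_ofPred.2 fun _ => le_of_lt)

namespace IsEvolutionSolution

theorem memLp_operator (hA : ∀ S, ∃ L, LipschitzOnWith L A {x | ‖j x‖ ≤ S})
    (hu : IsEvolutionSolution j A f τ T u U) :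
    MemLp (fun t => A (U t)) 2 (volume.restrict (Ioo τ T)) := by
  obtain ⟨S, hS⟩ := hu.ae_bounded
  obtain ⟨L, hL⟩ := hA (max S 0)
  have hAU := (continuous_of_lipschitzOnWith_pivot_ball hA).comp_aestronglyMeasurable hu.memLp.1
  refine ((hu.memLp.norm.const_mul (L : ℝ)).add (memLp_const ‖A 0‖)).mono' hAU ?_
  filter_upwards [hu.ae_eq, hS] with t htu htS
  have hUt : U t ∈ {x | ‖j x‖ ≤ max S 0} := by
    rw [mem_ofPred_eq, ← htu]
    exact htS.trans (le_max_left S 0)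
  have hlip : ‖A (U t) - A 0‖ ≤ L * ‖U t‖ := by
    simpa using hL.norm_sub_le hUt (y := 0) (by simp)
  exact (norm_le_norm_sub_add _ _).trans (add_le_add_left hlip _)

theorem hasDistribDerivOn_sub (hA : ∀ S, ∃ L, LipschitzOnWith L A {x | ‖j x‖ ≤ S})
    (hu : IsEvolutionSolution j A f τ T u U) (hv : IsEvolutionSolution j A f τ T v U₂) (z : X) :
    HasDistribDerivOn (fun t => inner ℝ (u t - v t) (j z)) (fun t => (A (U₂ t) - A (U t)) z)
      (Ioo τ T) := by
  intro φ hφ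
  have hAi {w : ℝ → Y} {W : ℝ → X} (hw : IsEvolutionSolution j A f τ T w W) :
      IntegrableOn (fun t => A (W t) z) (Ioo τ T) :=
    ((hw.memLp_operator hA).integrable one_le_two).apply_continuousLinearMap z
  have hci {w : ℝ → Y} {W : ℝ → X} (hw : IsEvolutionSolution j A f τ T w W) :
      IntegrableOn (fun t => inner ℝ (w t) (j z)) (Ioo τ T) :=
    (hw.continuousOn z).integrableOn_Icc.mono_set Ioo_subset_Icc_self
  simp only [inner_sub_left, sub_apply, sub_mul]
  rw [integral_sub (hφ.integrableOn_mul_deriv (hci hu)) (hφ.integrableOn_mul_deriv (hci hv)),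
    integral_sub (hφ.integrableOn_mul (hAi hv)) (hφ.integrableOn_mul (hAi hu))]
  linarith [hu.equation z φ hφ, hv.equation z φ hφ]

theorem unique (hA : ∀ S, ∃ L, LipschitzOnWith L A {x | ‖j x‖ ≤ S})
    (hmono : ∀ S, ∃ C, ∀ x y, ‖j x‖ ≤ S → ‖j y‖ ≤ S →
      -(C * ‖j (x - y)‖ ^ 2) ≤ (A x - A y) (x - y)) (hτT : τ < T)
    (hu : IsEvolutionSolution j A f τ T u U) (hv : IsEvolutionSolution j A f τ T v U₂)
    (h0 : u τ = v τ) : ∀ᵐ t ∂volume.restrict (Ioo τ T), u t = v t := by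
  obtain ⟨Su, hSu⟩ := hu.ae_bounded
  obtain ⟨Sv, hSv⟩ := hv.ae_bounded
  obtain ⟨C, hC⟩ := hmono (max Su Sv)
  have hzero := ae_eq_zero_of_hasDistribDerivOn (w := fun t => u t - v t) (C := C) j hτT
    ((hv.memLp_operator hA).sub (hu.memLp_operator hA)) (hu.memLp.sub hv.memLp) ?_
    (fun z => by simpa only [inner_sub_left] using! (hu.continuousOn z).sub (hv.continuousOn z))
    (sub_eq_zero.2 h0) (hu.hasDistribDerivOn_sub hA hv) ?_
  · exact hzero.mono fun t => sub_eq_zero.1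
  · filter_upwards [hu.ae_eq, hv.ae_eq] with t htu htv
    rw [htu, htv, Pi.sub_apply, map_sub]
  · filter_upwards [hu.ae_eq, hv.ae_eq, hSu, hSv] with t htu htv htSu htSv
    have hlower := hC (U t) (U₂ t) (htu ▸ htSu.trans (le_max_left Su Sv))
      (htv ▸ htSv.trans (le_max_right Su Sv))
    rw [← neg_sub (A (U₂ t)), neg_apply] at hlower
    exact neg_le_neg_iff.1 hlower

end IsEvolutionSolution

end Evolution

section Spaces

/-- The embedding of `V` into `(L²(Ω))³` as a continuous linear map. -/
noncomputable def toFieldL (Ω : Set E3) : V Ω →L[ℝ] L2 Ω :=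
  (WithLp.fstL 2 ℝ (L2 Ω) (PiLp 2 (fun _ : Fin 3 => L2 Ω))).comp (V Ω).subtypeL

/-- The gradient as a continuous linear map on `V`. -/
noncomputable def gradL (Ω : Set E3) : V Ω →L[ℝ] PiLp 2 (fun _ : Fin 3 => L2 Ω) :=
  (WithLp.sndL 2 ℝ (L2 Ω) (PiLp 2 (fun _ : Fin 3 => L2 Ω))).comp (V Ω).subtypeL

variable {Ω : Set E3}

@[simp]
theorem toFieldL_apply (u : V Ω) : toFieldL Ω u = toField u := rfl

theorem toField_neg (u : V Ω) : toField (-u) = -toField u := rfl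

theorem toField_sub (u v : V Ω) : toField (u - v) = toField u - toField v := rfl

theorem grad_sub (u v : V Ω) : grad (u - v) = grad u - grad v := rfl

theorem normV_nonneg (u : V Ω) : 0 ≤ normV u := norm_nonneg _

theorem innerV_self (u : V Ω) : innerV u u = normV u ^ 2 := real_inner_self_eq_norm_sq (grad u)

theorem abs_innerV_le (u v : V Ω) : |innerV u v| ≤ normV u * normV v :=
  abs_real_inner_le_norm (grad u) (grad v)

theorem innerV_sub_left (u v w : V Ω) : innerV (u - v) w = innerV u w - innerV v w :=
  inner_sub_left (grad u) (grad v) (grad w)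

theorem normV_sub_comm (u v : V Ω) : normV (u - v) = normV (v - u) := norm_sub_rev (grad u) (grad v)

theorem normV_sub_normV_le (u v : V Ω) : normV u - normV v ≤ normV (u - v) :=
  norm_sub_norm_le (grad u) (grad v)

theorem continuous_normV : Continuous (normV : V Ω → ℝ) := (gradL Ω).continuous.norm

theorem norm_grad_apply_le (u : V Ω) (i : Fin 3) : ‖grad u i‖ ≤ normV u :=
  PiLp.norm_apply_le _ i

theorem normV_le_norm (u : V Ω) : normV u ≤ ‖u‖ :=
  WithLp.norm_snd_le (x := (u : H1Ambient Ω)) ..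

theorem norm_toField_le (u : V Ω) : ‖toField u‖ ≤ ‖u‖ :=
  WithLp.norm_fst_le (x := (u : H1Ambient Ω)) ..

theorem partialDeriv_add {φ ψ : E3 → E3} (hφ : Differentiable ℝ φ) (hψ : Differentiable ℝ ψ)
    (i : Fin 3) : partialDeriv i (φ + ψ) = partialDeriv i φ + partialDeriv i ψ := by
  ext1 x
  simp [partialDeriv, fderiv_add (hφ x) (hψ x)]

theorem partialDeriv_const_smul {φ : E3 → E3} (c : ℝ) (hφ : Differentiable ℝ φ) (i : Fin 3) :
    partialDeriv i (c • φ) = c • partialDeriv i φ := by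
  ext1 x
  simp [partialDeriv, fderiv_const_smul (hφ x) c]

theorem differentiable_of_mem_testFields {φ : E3 → E3} (hφ : φ ∈ testFields Ω) :
    Differentiable ℝ φ :=
  hφ.1.differentiable (by simp)

theorem zero_mem_testFields : (0 : E3 → E3) ∈ testFields Ω :=
  ⟨contDiff_const, HasCompactSupport.zero, by simp, fun x => by simp [divergence, partialDeriv]⟩

theorem add_mem_testFields {φ ψ : E3 → E3} (hφ : φ ∈ testFields Ω) (hψ : ψ ∈ testFields Ω) :
    φ + ψ ∈ testFields Ω := by
  refine ⟨hφ.1.add hψ.1, hφ.2.1.add hψ.2.1,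
    (tsupport_add φ ψ).trans (union_subset hφ.2.2.1 hψ.2.2.1), fun x => ?_⟩
  have hdiv : divergence (φ + ψ) x = divergence φ x + divergence ψ x := by
    simp only [divergence, partialDeriv_add (differentiable_of_mem_testFields hφ)
      (differentiable_of_mem_testFields hψ), Pi.add_apply, PiLp.add_apply, Finset.sum_add_distrib]
  rw [hdiv, hφ.2.2.2 x, hψ.2.2.2 x, add_zero]

theorem smul_mem_testFields {φ : E3 → E3} (c : ℝ) (hφ : φ ∈ testFields Ω) :
    c • φ ∈ testFields Ω := by
  refine ⟨contDiff_const.smul hφ.1, hφ.2.1.smul_left (f := fun _ => c),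
    (closure_mono (Function.support_const_smul_subset c φ)).trans hφ.2.2.1, fun x => ?_⟩
  have hdiv : divergence (c • φ) x = c * divergence φ x := by
    simp only [divergence, partialDeriv_const_smul c (differentiable_of_mem_testFields hφ),
      Pi.smul_apply, PiLp.smul_apply, smul_eq_mul, Finset.mul_sum]
  rw [hdiv, hφ.2.2.2 x, mul_zero]

/-- The elements of `V` given by a test field in `𝒱` and its classical partial derivatives. -/
def testElements (Ω : Set E3) : Set (V Ω) :=
  {u | ∃ φ ∈ testFields Ω, (toField u : E3 → E3) =ᵐ[volume.restrict Ω] φ ∧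
    ∀ i : Fin 3, (grad u i : E3 → E3) =ᵐ[volume.restrict Ω] partialDeriv i φ}

theorem exists_testField_of_mem_span {z : H1Ambient Ω}
    (hz : z ∈ Submodule.span ℝ {z : H1Ambient Ω | ∃ φ ∈ testFields Ω,
      (z.fst : E3 → E3) =ᵐ[volume.restrict Ω] φ ∧
      ∀ i : Fin 3, (z.snd i : E3 → E3) =ᵐ[volume.restrict Ω] partialDeriv i φ}) :
    ∃ φ ∈ testFields Ω, (z.fst : E3 → E3) =ᵐ[volume.restrict Ω] φ ∧
      ∀ i : Fin 3, (z.snd i : E3 → E3) =ᵐ[volume.restrict Ω] partialDeriv i φ := by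
  induction hz using Submodule.span_induction with
  | mem _ hx => exact hx
  | zero =>
    refine ⟨0, zero_mem_testFields, Lp.coeFn_zero _ _ _, fun i => ?_⟩
    refine (Lp.coeFn_zero E3 2 (volume.restrict Ω)).trans (Eventually.of_forall fun x => ?_)
    simp [partialDeriv]
  | add x y _ _ hx hy =>
    obtain ⟨φ, hφ, hxφ, hdφ⟩ := hx
    obtain ⟨ψ, hψ, hyψ, hdψ⟩ := hy
    refine ⟨φ + ψ, add_mem_testFields hφ hψ, (Lp.coeFn_add _ _).trans (hxφ.add hyψ), fun i => ?_⟩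
    rw [partialDeriv_add (differentiable_of_mem_testFields hφ)
      (differentiable_of_mem_testFields hψ)]
    exact (Lp.coeFn_add _ _).trans ((hdφ i).add (hdψ i))
  | smul c x _ hx =>
    obtain ⟨φ, hφ, hxφ, hdφ⟩ := hx
    refine ⟨c • φ, smul_mem_testFields c hφ, (Lp.coeFn_smul _ _).trans (hxφ.const_smul c),
      fun i => ?_⟩
    rw [partialDeriv_const_smul c (differentiable_of_mem_testFields hφ)]
    exact (Lp.coeFn_smul _ _).trans ((hdφ i).const_smul c)

theorem dense_testElements : Dense (testElements Ω) := by
  rw [Subtype.dense_iff]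
  intro z hz
  refine closure_mono ?_ (show z ∈ closure (_ : Set (H1Ambient Ω)) from hz)
  intro y hy
  exact ⟨⟨y, subset_closure hy⟩, exists_testField_of_mem_span hy, rfl⟩

theorem toField_mem_H (u : V Ω) : toField u ∈ H Ω := by
  have hclosed : IsClosed {u : V Ω | toField u ∈ H Ω} :=
    (Submodule.isClosed_topologicalClosure _).preimage (toFieldL Ω).continuous
  refine dense_testElements.induction (P := fun u => toField u ∈ H Ω) ?_ hclosed u
  rintro u ⟨φ, hφ, hu, -⟩
  exact Submodule.le_topologicalClosure _ (Submodule.subset_span ⟨φ, hφ, hu⟩)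

end Spaces

section Sobolev

variable {Ω : Set E3}

theorem norm_fderiv_le_sum_norm_partialDeriv (φ : E3 → E3) (x : E3) :
    ‖fderiv ℝ φ x‖ ≤ ∑ i : Fin 3, ‖partialDeriv i φ x‖ := by
  refine ContinuousLinearMap.opNorm_le_bound _ (Finset.sum_nonneg fun _ _ => norm_nonneg _)
    fun v => ?_
  have hv : fderiv ℝ φ x v = ∑ i : Fin 3, v i • partialDeriv i φ x := by
    conv_lhs => rw [← (EuclideanSpace.basisFun (Fin 3) ℝ).sum_repr v]
    simp [partialDeriv]
  rw [hv, Finset.sum_mul]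
  refine norm_sum_le_of_le _ fun i _ => ?_
  rw [norm_smul, mul_comm]
  gcongr
  exact PiLp.norm_apply_le v i

theorem eLpNorm_fderiv_le_sum {φ : E3 → E3} (hφ : ContDiff ℝ 1 φ) :
    eLpNorm (fderiv ℝ φ) 2 volume ≤ ∑ i : Fin 3, eLpNorm (partialDeriv i φ) 2 volume := by
  have hmeas (i : Fin 3) : AEStronglyMeasurable (partialDeriv i φ) volume :=
    ((hφ.continuous_fderiv one_ne_zero).clm_apply continuous_const).aestronglyMeasurable
  calc eLpNorm (fderiv ℝ φ) 2 volume
      ≤ eLpNorm (∑ i : Fin 3, fun x => ‖partialDeriv i φ x‖) 2 volume :=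
        eLpNorm_mono_real fun x => by simpa using norm_fderiv_le_sum_norm_partialDeriv φ x
    _ ≤ ∑ i : Fin 3, eLpNorm (fun x => ‖partialDeriv i φ x‖) 2 volume :=
        eLpNorm_sum_le (fun i _ => (hmeas i).norm) one_le_two
    _ = ∑ i : Fin 3, eLpNorm (partialDeriv i φ) 2 volume := by simp only [eLpNorm_norm]

/-- A constant in the inequality `‖u‖_{L⁶} ≤ C ‖∇u‖_{L²}` on `V`: Mathlib's constant for the
operator norm of the derivative, times three because that norm is at most the sum of the norms
of the three partial derivatives. -/
@[irreducible]
noncomputable def sobolevConst : ℝ :=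
  SNormLESNormFDerivOfEqConst E3 (volume : Measure E3) 2 * 3

theorem sobolevConst_nonneg : 0 ≤ sobolevConst := by
  unfold sobolevConst
  positivity

theorem eLpNorm_six_le_of_mem_testElements {u : V Ω} (hu : u ∈ testElements Ω) :
    eLpNorm (toField u : E3 → E3) 6 (volume.restrict Ω) ≤
      ENNReal.ofReal (sobolevConst * normV u) := by
  obtain ⟨φ, ⟨hsmooth, hcomp, hsupp, -⟩, huφ, hdφ⟩ := hu
  have hφ : ContDiff ℝ 1 φ := hsmooth.of_le (by norm_num)
  have hpartial (i : Fin 3) : eLpNorm (partialDeriv i φ) 2 volume ≤ ENNReal.ofReal (normV u) := by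
    have hsub : Function.support (partialDeriv i φ) ⊆ Ω :=
      (subset_tsupport _).trans ((tsupport_fderiv_apply_subset ℝ _).trans hsupp)
    rw [← eLpNorm_restrict_eq_of_support_subset hsub, ← eLpNorm_congr_ae (hdφ i),
      ← Lp.enorm_def, ← ofReal_norm]
    exact ENNReal.ofReal_le_ofReal (norm_grad_apply_le u i)
  have hgrad : eLpNorm (fderiv ℝ φ) 2 volume ≤ 3 * ENNReal.ofReal (normV u) :=
    (eLpNorm_fderiv_le_sum hφ).trans
      ((Finset.sum_le_sum fun i _ => hpartial i).trans_eq (by simp))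
  calc eLpNorm (toField u : E3 → E3) 6 (volume.restrict Ω)
      ≤ eLpNorm φ 6 volume := (eLpNorm_congr_ae huφ).trans_le (eLpNorm_restrict_le _ _ _ _)
    _ ≤ SNormLESNormFDerivOfEqConst E3 (volume : Measure E3) 2 * eLpNorm (fderiv ℝ φ) 2 volume :=
        eLpNorm_le_eLpNorm_fderiv_of_eq (volume : Measure E3) hφ hcomp (p := 2) (p' := 6)
          (by norm_num) (by simp) (by simp; norm_num)
    _ ≤ SNormLESNormFDerivOfEqConst E3 (volume : Measure E3) 2 *
          (3 * ENNReal.ofReal (normV u)) := by gcongr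
    _ = ENNReal.ofReal (sobolevConst * normV u) := by
        rw [sobolevConst, ENNReal.ofReal_mul (by positivity), ENNReal.ofReal_mul (by positivity)]
        simp [mul_assoc]

theorem eLpNorm_six_le (u : V Ω) :
    eLpNorm (toField u : E3 → E3) 6 (volume.restrict Ω) ≤
      ENNReal.ofReal (sobolevConst * normV u) := by
  obtain ⟨z, hz, hlim⟩ := mem_closure_iff_seq_limit.1 (dense_testElements u)
  have hfield : Tendsto (fun n => toField (z n)) atTop (𝓝 (toField u)) :=
    ((toFieldL Ω).continuous.tendsto u).comp hlim
  obtain ⟨ns, hns, hae⟩ := (tendstoInMeasure_of_tendsto_Lp hfield).exists_seq_tendsto_ae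
  have hbound : Tendsto (fun n => ENNReal.ofReal (sobolevConst * normV (z (ns n)))) atTop
      (𝓝 (ENNReal.ofReal (sobolevConst * normV u))) :=
    ENNReal.tendsto_ofReal (((continuous_normV.tendsto u).comp
      (hlim.comp hns.tendsto_atTop)).const_mul sobolevConst)
  rw [← hbound.liminf_eq]
  exact (Lp.eLpNorm_lim_le_liminf_eLpNorm (fun _ => Lp.aestronglyMeasurable _) _ hae).trans
    (liminf_le_liminf (Eventually.of_forall fun n => eLpNorm_six_le_of_mem_testElements (hz _)))

theorem memLp_two (u : V Ω) : MemLp (toField u : E3 → E3) 2 (volume.restrict Ω) :=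
  Lp.memLp (toField u)

theorem memLp_six (u : V Ω) : MemLp (toField u : E3 → E3) 6 (volume.restrict Ω) :=
  ⟨Lp.aestronglyMeasurable _, (eLpNorm_six_le u).trans_lt ENNReal.ofReal_lt_top⟩

theorem lpNorm_two_eq_norm (g : L2 Ω) : lpNorm (g : E3 → E3) 2 (volume.restrict Ω) = ‖g‖ := by
  rw [← toReal_eLpNorm (Lp.aestronglyMeasurable g), Lp.norm_def]

theorem lpNorm_six_le (u : V Ω) :
    lpNorm (toField u : E3 → E3) 6 (volume.restrict Ω) ≤ sobolevConst * normV u := by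
  rw [← toReal_eLpNorm (Lp.aestronglyMeasurable _)]
  exact ENNReal.toReal_le_of_le_ofReal (mul_nonneg sobolevConst_nonneg (normV_nonneg u))
    (eLpNorm_six_le u)

end Sobolev

section Holder

variable {α E : Type*} [MeasurableSpace α] [NormedAddCommGroup E] {ν : Measure α}
  {p q r s : ℝ≥0∞}

theorem lpNorm_congr_ae {f g : α → E} (h : f =ᵐ[ν] g) : lpNorm f p ν = lpNorm g p ν := by
  by_cases hf : AEStronglyMeasurable f ν
  · rw [← toReal_eLpNorm hf, ← toReal_eLpNorm (hf.congr h), eLpNorm_congr_ae h]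
  · rw [lpNorm_of_not_aestronglyMeasurable hf,
      lpNorm_of_not_aestronglyMeasurable fun hg => hf (hg.congr h.symm)]

theorem lpNorm_smul_le_mul_lpNorm [NormedSpace ℝ E] [ENNReal.HolderTriple p q r]
    {φ : α → ℝ} {f : α → E} (hφ : MemLp φ p ν) (hf : MemLp f q ν) :
    lpNorm (φ • f) r ν ≤ lpNorm φ p ν * lpNorm f q ν := by
  rw [← toReal_eLpNorm hφ.1, ← toReal_eLpNorm hf.1, ← toReal_eLpNorm (hφ.1.smul hf.1),
    ← ENNReal.toReal_mul]
  exact ENNReal.toReal_mono (ENNReal.mul_ne_top hφ.2.ne hf.2.ne)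
    (eLpNorm_smul_le_mul_eLpNorm hf.1 hφ.1)

theorem lpNorm_norm_rpow {f : α → E} {t : ℝ} (hf : AEStronglyMeasurable f ν) (ht : 0 < t) :
    lpNorm (fun x => ‖f x‖ ^ t) p ν = lpNorm f (p * ENNReal.ofReal t) ν ^ t := by
  have hm : AEStronglyMeasurable (fun x => ‖f x‖ ^ t) ν :=
    (Real.continuous_rpow_const ht.le).comp_aestronglyMeasurable hf.norm
  rw [← toReal_eLpNorm hm, ← toReal_eLpNorm hf, eLpNorm_norm_rpow f ht, ENNReal.toReal_rpow]

theorem memLp_norm_rpow {f : α → E} {t : ℝ} (ht : 0 < t)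
    (hf : MemLp f (p * ENNReal.ofReal t) ν) : MemLp (fun x => ‖f x‖ ^ t) p ν := by
  refine ⟨(Real.continuous_rpow_const ht.le).comp_aestronglyMeasurable hf.1.norm, ?_⟩
  rw [eLpNorm_norm_rpow f ht]
  exact ENNReal.rpow_lt_top_of_nonneg ht.le hf.2.ne

instance holderTriple_four_twelve_three : ENNReal.HolderTriple 4 12 3 :=
  .of_toReal ⟨by norm_num, by norm_num, by norm_num⟩

instance holderTriple_six_three_two : ENNReal.HolderTriple 6 3 2 :=
  .of_toReal ⟨by norm_num, by norm_num, by norm_num⟩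

instance holderTriple_six_six_three : ENNReal.HolderTriple 6 6 3 :=
  .of_toReal ⟨by norm_num, by norm_num, by norm_num⟩

theorem memLp_of_exponent_mem_Icc {f : α → E} (hp : p ≠ 0) (hr : r ≠ ⊤) (hq : q ∈ Icc p r)
    (hfp : MemLp f p ν) (hfr : MemLp f r ν) : MemLp f q ν := by
  have hq_top : q ≠ ⊤ := ne_top_of_le_ne_top hr hq.2
  have hpq : p.toReal ≤ q.toReal := ENNReal.toReal_mono hq_top hq.1
  have hqr : q.toReal ≤ r.toReal := ENNReal.toReal_mono hr hq.2
  have hp_pos : 0 < p.toReal := ENNReal.toReal_pos hp (ne_top_of_le_ne_top hq_top hq.1)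
  have hq_pos : 0 < q.toReal := hp_pos.trans_le hpq
  have hle (x : α) : ‖f x‖ ^ q.toReal ≤ ‖f x‖ ^ p.toReal + ‖f x‖ ^ r.toReal := by
    rcases le_total ‖f x‖ 1 with h | h
    · refine (Real.rpow_le_rpow_of_exponent_ge_of_imp (norm_nonneg _) h hpq ?_).trans
        (le_add_of_nonneg_right (by positivity))
      exact fun _ h0 => absurd h0 hq_pos.ne'
    · exact (Real.rpow_le_rpow_of_exponent_le h hqr).trans
        (le_add_of_nonneg_left (by positivity))
  rw [← integrable_norm_rpow_iff hfp.1 (ne_bot_of_le_ne_bot hp hq.1) hq_top]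
  refine Integrable.mono' ((hfp.integrable_norm_rpow hp (ne_top_of_le_ne_top hq_top hq.1)).add
    (hfr.integrable_norm_rpow (ne_bot_of_le_ne_bot hp (hq.1.trans hq.2)) hr))
    ((Real.continuous_rpow_const hq_pos.le).comp_aestronglyMeasurable hfp.1.norm)
    (.of_forall fun x => ?_)
  rw [Real.norm_of_nonneg (by positivity)]
  exact hle x

theorem sq_lpNorm_three_le {f : α → E} (hf₂ : MemLp f 2 ν) (hf₆ : MemLp f 6 ν) :
    lpNorm f 3 ν ^ 2 ≤ lpNorm f 2 ν * lpNorm f 6 ν := by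
  have h4 : (4 : ℝ≥0∞) * ENNReal.ofReal (1 / 2) = 2 := by
    rw [← ENNReal.toReal_eq_toReal_iff' (by finiteness) (by simp)]
    norm_num
  have h12 : (12 : ℝ≥0∞) * ENNReal.ofReal (1 / 2) = 6 := by
    rw [← ENNReal.toReal_eq_toReal_iff' (by finiteness) (by simp)]
    norm_num
  have hhalf : (fun x => ‖f x‖) =
      (fun x => ‖f x‖ ^ (1 / 2 : ℝ)) • fun x => ‖f x‖ ^ (1 / 2 : ℝ) := by
    ext x
    simp only [Pi.smul_apply', smul_eq_mul]
    rw [← Real.rpow_add_of_nonneg (norm_nonneg _) (by norm_num) (by norm_num)]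
    norm_num
  have hle : lpNorm f 3 ν ≤ √(lpNorm f 2 ν) * √(lpNorm f 6 ν) := by
    rw [← lpNorm_norm hf₂.1, hhalf]
    refine (lpNorm_smul_le_mul_lpNorm (p := 4) (q := 12)
      (memLp_norm_rpow (by norm_num) (by rwa [h4]))
      (memLp_norm_rpow (by norm_num) (by rwa [h12]))).trans_eq ?_
    rw [lpNorm_norm_rpow hf₂.1 (by norm_num), lpNorm_norm_rpow hf₂.1 (by norm_num), h4, h12,
      Real.sqrt_eq_rpow, Real.sqrt_eq_rpow]
  calc lpNorm f 3 ν ^ 2 ≤ (√(lpNorm f 2 ν) * √(lpNorm f 6 ν)) ^ 2 := by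
        gcongr
        exact lpNorm_nonneg
    _ = lpNorm f 2 ν * lpNorm f 6 ν := by
        rw [mul_pow, Real.sq_sqrt lpNorm_nonneg, Real.sq_sqrt lpNorm_nonneg]

theorem integrable_norm_mul_norm_mul_norm [ENNReal.HolderTriple p q r]
    [ENNReal.HolderTriple r s 1] {f g h : α → E} (hf : MemLp f p ν) (hg : MemLp g q ν)
    (hh : MemLp h s ν) : Integrable (fun x => ‖f x‖ * ‖g x‖ * ‖h x‖) ν := by
  have hfg : MemLp (fun x => ‖f x‖ * ‖g x‖) r ν := hg.norm.smul hf.norm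
  exact memLp_one_iff_integrable.1 (hh.norm.smul hfg)

theorem integral_norm_mul_norm_mul_norm_le [ENNReal.HolderTriple p q r]
    [ENNReal.HolderTriple r s 1] {f g h : α → E} (hf : MemLp f p ν) (hg : MemLp g q ν)
    (hh : MemLp h s ν) :
    ∫ x, ‖f x‖ * ‖g x‖ * ‖h x‖ ∂ν ≤ lpNorm f p ν * lpNorm g q ν * lpNorm h s ν := by
  have hfg : MemLp ((fun x => ‖f x‖) • fun x => ‖g x‖) r ν := hg.norm.smul hf.norm
  calc ∫ x, ‖f x‖ * ‖g x‖ * ‖h x‖ ∂ν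
      = lpNorm (((fun x => ‖f x‖) • fun x => ‖g x‖) • fun x => ‖h x‖) 1 ν := by
        rw [lpNorm_one_eq_integral_norm (hfg.1.smul hh.1.norm)]
        exact integral_congr_ae (.of_forall fun x => (Real.norm_of_nonneg
          (mul_nonneg (mul_nonneg (norm_nonneg _) (norm_nonneg _)) (norm_nonneg _))).symm)
    _ ≤ lpNorm ((fun x => ‖f x‖) • fun x => ‖g x‖) r ν * lpNorm (fun x => ‖h x‖) s ν :=
        lpNorm_smul_le_mul_lpNorm hfg hh.norm
    _ ≤ lpNorm (fun x => ‖f x‖) p ν * lpNorm (fun x => ‖g x‖) q ν *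
          lpNorm (fun x => ‖h x‖) s ν := by
        gcongr
        · exact lpNorm_nonneg
        · exact lpNorm_smul_le_mul_lpNorm hf.norm hg.norm
    _ = lpNorm f p ν * lpNorm g q ν * lpNorm h s ν := by
        rw [lpNorm_norm hf.1, lpNorm_norm hg.1, lpNorm_norm hh.1]

end Holder

section Cutoff

variable {N γ r s : ℝ}

theorem cutoff_eq (hN : 0 < N) (hr : 0 ≤ r) : cutoff N r = N / max N r := by
  rcases hr.eq_or_lt with rfl | hr
  · rw [cutoff, if_pos rfl, max_eq_left hN.le, div_self hN.ne']
  · rw [cutoff, if_neg hr.ne']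
    rcases le_total N r with h | h
    · rw [max_eq_right h, min_eq_right ((div_le_one hr).2 h)]
    · rw [max_eq_left h, div_self hN.ne', min_eq_left ((one_le_div hr).2 h)]

theorem cutoff_nonneg (hN : 0 < N) (hr : 0 ≤ r) : 0 ≤ cutoff N r := by
  rw [cutoff_eq hN hr]
  positivity

theorem cutoff_mul_le (hN : 0 < N) (hr : 0 ≤ r) : cutoff N r * r ≤ N := by
  rw [cutoff_eq hN hr, div_mul_eq_mul_div, div_le_iff₀ (lt_max_of_lt_left hN)]
  gcongr
  exact le_max_right N r

theorem cutoff_anti (hN : 0 < N) (hs : 0 ≤ s) (hsr : s ≤ r) : cutoff N r ≤ cutoff N s := by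
  rw [cutoff_eq hN hs, cutoff_eq hN (hs.trans hsr)]
  gcongr

theorem rpow_sub_rpow_mul_le (hγ₀ : 0 ≤ γ) (hγ₂ : γ ≤ 2) (hs : 0 ≤ s) (hsr : s ≤ r) :
    (r ^ γ - s ^ γ) * r ≤ 2 * r ^ γ * (r - s) := by
  rcases (hs.trans hsr).eq_or_lt with rfl | hr
  · obtain rfl := le_antisymm hsr hs
    simp
  have hsq : (s / r) ^ 2 ≤ s ^ γ / r ^ γ := by
    rw [← Real.div_rpow hs hr.le, ← Real.rpow_two]
    exact Real.rpow_le_rpow_of_exponent_ge' (by positivity) ((div_le_one hr).2 hsr) hγ₀ hγ₂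
  have hlin : 2 * (s / r) - 1 ≤ (s / r) ^ 2 := by nlinarith [sq_nonneg (s / r - 1)]
  have hrγ : 0 < r ^ γ := by positivity
  have hbern : (2 * (s / r) - 1) * r ^ γ ≤ s ^ γ := (le_div_iff₀ hrγ).1 (hlin.trans hsq)
  calc (r ^ γ - s ^ γ) * r ≤ (r ^ γ - (2 * (s / r) - 1) * r ^ γ) * r := by gcongr
    _ = 2 * r ^ γ * (r - s) := by field_simp; ring

theorem cutoff_rpow_eq (hN : 0 < N) (hγ : 0 < γ) (hr : 0 ≤ r) :
    cutoff N (r ^ γ) = N / max (N ^ γ⁻¹) r ^ γ := by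
  rw [cutoff_eq hN (by positivity)]
  congr 1
  have hroot : (N ^ γ⁻¹) ^ γ = N := Real.rpow_inv_rpow hN.le hγ.ne'
  rcases le_total (N ^ γ⁻¹) r with h | h
  · rw [max_eq_right h, max_eq_right (hroot ▸ Real.rpow_le_rpow (by positivity) h hγ.le)]
  · rw [max_eq_left h, hroot, max_eq_left (hroot ▸ Real.rpow_le_rpow hr h hγ.le)]

/-- Below the threshold `ρ` the cutoff is constant, which is why the factor `max ρ s` can replace
`s` and the bound stays useful as `s → 0`. -/
theorem exists_cutoff_rpow_sub_mul_le (hN : 0 < N) (hγ₀ : 0 ≤ γ) (hγ₂ : γ ≤ 2) :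
    ∃ ρ > 0, ∀ s r : ℝ, 0 ≤ s → s ≤ r →
      (cutoff N (s ^ γ) - cutoff N (r ^ γ)) * s ^ γ * max ρ s ≤ 2 * N * (r - s) := by
  rcases hγ₀.eq_or_lt with rfl | hγ
  · refine ⟨1, one_pos, fun s r _ hsr => ?_⟩
    have hnonneg : 0 ≤ 2 * N * (r - s) := mul_nonneg (by positivity) (sub_nonneg.2 hsr)
    simpa only [Real.rpow_zero, sub_self, zero_mul] using hnonneg
  refine ⟨N ^ γ⁻¹, by positivity, fun s r hs hsr => ?_⟩
  rw [cutoff_rpow_eq hN hγ hs, cutoff_rpow_eq hN hγ (hs.trans hsr)]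
  set m := max (N ^ γ⁻¹) s
  set M := max (N ^ γ⁻¹) r
  have hm : 0 < m := lt_max_of_lt_left (by positivity)
  have hM : 0 < M := lt_max_of_lt_left (by positivity)
  have hmM : m ≤ M := max_le_max_left _ hsr
  have hdist : M - m ≤ r - s := by
    refine (le_abs_self _).trans ((abs_max_sub_max_le_max _ _ _ _).trans_eq ?_)
    rw [sub_self, abs_zero, abs_of_nonneg (sub_nonneg.2 hsr), max_eq_right (sub_nonneg.2 hsr)]
  calc (N / m ^ γ - N / M ^ γ) * s ^ γ * m ≤ (N / m ^ γ - N / M ^ γ) * m ^ γ * M := by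
        have hmono : N / M ^ γ ≤ N / m ^ γ := by gcongr
        have hsm : s ≤ m := le_max_right _ s
        have hnonneg : 0 ≤ N / m ^ γ - N / M ^ γ := sub_nonneg.2 hmono
        exact mul_le_mul (mul_le_mul_of_nonneg_left (Real.rpow_le_rpow hs hsm hγ₀) hnonneg) hmM
          hm.le (mul_nonneg hnonneg (by positivity))
    _ = N * ((M ^ γ - m ^ γ) * M) / M ^ γ := by field_simp
    _ ≤ N * (2 * M ^ γ * (M - m)) / M ^ γ := by
        exact div_le_div_of_nonneg_right (mul_le_mul_of_nonneg_left
          (rpow_sub_rpow_mul_le hγ₀ hγ₂ hm.le hmM) hN.le) (by positivity)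
    _ = 2 * N * (M - m) := by field_simp
    _ ≤ 2 * N * (r - s) := by gcongr

theorem cutoff_sub_mul_sq_le (hN : 0 < N) (hs : 0 ≤ s) (hsr : s ≤ r) :
    (cutoff N s - cutoff N r) * s ^ 2 ≤ 2 * N * (r - s) := by
  obtain ⟨ρ, -, hρ⟩ := exists_cutoff_rpow_sub_mul_le hN zero_le_one one_le_two
  have hmono : 0 ≤ cutoff N s - cutoff N r := sub_nonneg.2 (cutoff_anti hN hs hsr)
  calc (cutoff N s - cutoff N r) * s ^ 2 = (cutoff N s - cutoff N r) * s * s := by ring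
    _ ≤ (cutoff N s - cutoff N r) * s * max ρ s := by
        gcongr
        exact le_max_right _ _
    _ ≤ 2 * N * (r - s) := by simpa only [Real.rpow_one] using hρ s r hs hsr

theorem exists_cutoff_rpow_sub_mul_add_le {S K : ℝ} (hN : 0 < N) (hγ₀ : 0 ≤ γ) (hγ₂ : γ ≤ 2)
    (hS : 0 ≤ S) (hK : 0 ≤ K) : ∃ C, 0 ≤ C ∧ ∀ s r : ℝ, 0 ≤ s → s ≤ r →
      (cutoff N (s ^ γ) - cutoff N (r ^ γ)) * s ^ γ * (S + K * s) ≤ C * (r - s) := by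
  obtain ⟨ρ, hρ_pos, hρ⟩ := exists_cutoff_rpow_sub_mul_le hN hγ₀ hγ₂
  refine ⟨(S / ρ + K) * (2 * N), by positivity, fun s r hs hsr => ?_⟩
  have hdiff : 0 ≤ cutoff N (s ^ γ) - cutoff N (r ^ γ) :=
    sub_nonneg.2 (cutoff_anti hN (by positivity) (Real.rpow_le_rpow hs hsr hγ₀))
  have hgrowth : S + K * s ≤ (S / ρ + K) * max ρ s :=
    calc S + K * s = S / ρ * ρ + K * s := by rw [div_mul_cancel₀ _ hρ_pos.ne']
      _ ≤ S / ρ * max ρ s + K * max ρ s := by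
          gcongr
          exacts [le_max_left _ _, le_max_right _ _]
      _ = (S / ρ + K) * max ρ s := by ring
  calc (cutoff N (s ^ γ) - cutoff N (r ^ γ)) * s ^ γ * (S + K * s)
      ≤ (cutoff N (s ^ γ) - cutoff N (r ^ γ)) * s ^ γ * ((S / ρ + K) * max ρ s) := by gcongr
    _ = (S / ρ + K) * ((cutoff N (s ^ γ) - cutoff N (r ^ γ)) * s ^ γ * max ρ s) := by ring
    _ ≤ (S / ρ + K) * (2 * N * (r - s)) := by
        gcongr ?_ * ?_
        exact hρ s r hs hsr
    _ = (S / ρ + K) * (2 * N) * (r - s) := by ring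

end Cutoff

section Power

variable {E : Type*} [NormedAddCommGroup E] [NormedSpace ℝ E] {γ : ℝ}

theorem norm_rpow_smul_sub_le (hγ₀ : 0 ≤ γ) (hγ₂ : γ ≤ 2) (a c : E) :
    ‖‖a‖ ^ γ • a - ‖c‖ ^ γ • c‖ ≤ 3 * ((‖a‖ ^ γ + ‖c‖ ^ γ) * ‖a - c‖) := by
  wlog h : ‖c‖ ≤ ‖a‖ generalizing a c
  · rw [norm_sub_rev, norm_sub_rev a c, add_comm]
    exact this c a (le_of_not_ge h)
  have hpow : 0 ≤ ‖a‖ ^ γ - ‖c‖ ^ γ := sub_nonneg.2 (Real.rpow_le_rpow (norm_nonneg c) h hγ₀)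
  have hdiff : (‖a‖ ^ γ - ‖c‖ ^ γ) * ‖c‖ ≤ 2 * ‖a‖ ^ γ * ‖a - c‖ :=
    calc (‖a‖ ^ γ - ‖c‖ ^ γ) * ‖c‖ ≤ (‖a‖ ^ γ - ‖c‖ ^ γ) * ‖a‖ := by gcongr
      _ ≤ 2 * ‖a‖ ^ γ * (‖a‖ - ‖c‖) := rpow_sub_rpow_mul_le hγ₀ hγ₂ (norm_nonneg c) h
      _ ≤ 2 * ‖a‖ ^ γ * ‖a - c‖ := by
        gcongr
        exact norm_sub_norm_le a c
  calc ‖‖a‖ ^ γ • a - ‖c‖ ^ γ • c‖ = ‖‖a‖ ^ γ • (a - c) + (‖a‖ ^ γ - ‖c‖ ^ γ) • c‖ := by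
        congr 1
        module
    _ ≤ ‖a‖ ^ γ * ‖a - c‖ + (‖a‖ ^ γ - ‖c‖ ^ γ) * ‖c‖ := by
        refine (norm_add_le _ _).trans_eq ?_
        rw [norm_smul, norm_smul, Real.norm_of_nonneg (by positivity), Real.norm_of_nonneg hpow]
    _ ≤ 3 * (‖a‖ ^ γ * ‖a - c‖) := by linarith
    _ ≤ 3 * ((‖a‖ ^ γ + ‖c‖ ^ γ) * ‖a - c‖) := by
        gcongr
        exact le_add_of_nonneg_right (by positivity)

variable {α : Type*} [MeasurableSpace α] {ν : Measure α} {f g z : α → E}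

theorem rpow_le_mul_one_add_sq {x c : ℝ} (hγ₀ : 0 ≤ γ) (hγ₂ : γ ≤ 2) (hx : 0 ≤ x) (hc : 0 < c) :
    x ^ γ ≤ c ^ γ * (1 + (x / c) ^ 2) := by
  have hone (y : ℝ) (hy : 0 ≤ y) : y ^ γ ≤ 1 + y ^ 2 := by
    rcases le_total y 1 with h | h
    · exact (Real.rpow_le_one hy h hγ₀).trans (le_add_of_nonneg_right (sq_nonneg y))
    · rw [← Real.rpow_two]
      exact (Real.rpow_le_rpow_of_exponent_le h hγ₂).trans (le_add_of_nonneg_left zero_le_one)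
  calc x ^ γ = c ^ γ * (x / c) ^ γ := by
        rw [← Real.mul_rpow hc.le (by positivity), mul_div_cancel₀ x hc.ne']
    _ ≤ c ^ γ * (1 + (x / c) ^ 2) := by
        gcongr
        exact hone _ (by positivity)

theorem memLp_norm_sq_smul_and_lpNorm_le (hf : MemLp f 6 ν) (hz : MemLp z 6 ν) :
    MemLp (fun x => ‖f x‖ ^ 2 • z x) 2 ν ∧
      lpNorm (fun x => ‖f x‖ ^ 2 • z x) 2 ν ≤ lpNorm f 6 ν ^ 2 * lpNorm z 6 ν := by
  have hfz : MemLp ((fun x => ‖f x‖) • z) 3 ν := hz.smul hf.norm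
  have heq : (fun x => ‖f x‖ ^ 2 • z x) = (fun x => ‖f x‖) • ((fun x => ‖f x‖) • z) := by
    ext1 x
    simp only [Pi.smul_apply', smul_smul, sq]
  rw [heq]
  refine ⟨hfz.smul (p := 6) hf.norm, ?_⟩
  calc lpNorm ((fun x => ‖f x‖) • ((fun x => ‖f x‖) • z)) 2 ν
      ≤ lpNorm f 6 ν * (lpNorm f 6 ν * lpNorm z 6 ν) := by
        refine (lpNorm_smul_le_mul_lpNorm hf.norm hfz).trans ?_
        rw [lpNorm_norm hf.1]
        gcongr
        · exact lpNorm_nonneg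
        · exact (lpNorm_smul_le_mul_lpNorm hf.norm hz).trans_eq (by rw [lpNorm_norm hf.1])
    _ = lpNorm f 6 ν ^ 2 * lpNorm z 6 ν := by ring

theorem aestronglyMeasurable_norm_rpow_smul (hγ : 0 ≤ γ) (hf : AEStronglyMeasurable f ν)
    (hz : AEStronglyMeasurable z ν) : AEStronglyMeasurable (fun x => ‖f x‖ ^ γ • z x) ν :=
  ((Real.continuous_rpow_const hγ).comp_aestronglyMeasurable hf.norm).smul hz

theorem memLp_norm_rpow_smul_and_lpNorm_le_of_lt {c : ℝ} (hγ₀ : 0 ≤ γ) (hγ₂ : γ ≤ 2)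
    (hf : MemLp f 6 ν) (hz₂ : MemLp z 2 ν) (hz₆ : MemLp z 6 ν) (hc : lpNorm f 6 ν < c) :
    MemLp (fun x => ‖f x‖ ^ γ • z x) 2 ν ∧
      lpNorm (fun x => ‖f x‖ ^ γ • z x) 2 ν ≤ c ^ γ * (lpNorm z 2 ν + lpNorm z 6 ν) := by
  have hc_pos : 0 < c := lpNorm_nonneg.trans_lt hc
  obtain ⟨hmem, hle⟩ := memLp_norm_sq_smul_and_lpNorm_le hf hz₆
  have hpt (x : α) : ‖‖f x‖ ^ γ • z x‖ ≤ c ^ γ * (‖z x‖ + (c ^ 2)⁻¹ * ‖‖f x‖ ^ 2 • z x‖) := by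
    rw [norm_smul, norm_smul, Real.norm_of_nonneg (by positivity),
      Real.norm_of_nonneg (by positivity)]
    calc ‖f x‖ ^ γ * ‖z x‖ ≤ c ^ γ * (1 + (‖f x‖ / c) ^ 2) * ‖z x‖ := by
          gcongr
          exact rpow_le_mul_one_add_sq hγ₀ hγ₂ (norm_nonneg _) hc_pos
      _ = c ^ γ * (‖z x‖ + (c ^ 2)⁻¹ * (‖f x‖ ^ 2 * ‖z x‖)) := by ring
  have hdom : MemLp (fun x => c ^ γ * (‖z x‖ + (c ^ 2)⁻¹ * ‖‖f x‖ ^ 2 • z x‖)) 2 ν :=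
    (hz₂.norm.add (hmem.norm.const_mul _)).const_mul _
  refine ⟨hdom.mono' (aestronglyMeasurable_norm_rpow_smul hγ₀ hf.1 hz₂.1) (.of_forall hpt), ?_⟩
  calc lpNorm (fun x => ‖f x‖ ^ γ • z x) 2 ν
      ≤ lpNorm (c ^ γ • ((fun x => ‖z x‖) + (c ^ 2)⁻¹ • fun x => ‖‖f x‖ ^ 2 • z x‖)) 2 ν :=
        lpNorm_mono_real hdom hpt
    _ ≤ c ^ γ * (lpNorm z 2 ν + (c ^ 2)⁻¹ * lpNorm (fun x => ‖f x‖ ^ 2 • z x) 2 ν) := by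
        rw [lpNorm_const_smul, coe_nnnorm, Real.norm_of_nonneg (by positivity)]
        gcongr
        refine (lpNorm_add_le hz₂.norm one_le_two).trans_eq ?_
        rw [lpNorm_const_smul, coe_nnnorm, Real.norm_of_nonneg (by positivity), lpNorm_norm hz₂.1,
          lpNorm_norm hmem.1]
    _ ≤ c ^ γ * (lpNorm z 2 ν + (c ^ 2)⁻¹ * (c ^ 2 * lpNorm z 6 ν)) := by
        gcongr
        refine hle.trans ?_
        gcongr
        exacts [lpNorm_nonneg, lpNorm_nonneg]
    _ = c ^ γ * (lpNorm z 2 ν + lpNorm z 6 ν) := by field_simp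

theorem memLp_norm_rpow_smul (hγ₀ : 0 ≤ γ) (hγ₂ : γ ≤ 2) (hf : MemLp f 6 ν) (hz₂ : MemLp z 2 ν)
    (hz₆ : MemLp z 6 ν) : MemLp (fun x => ‖f x‖ ^ γ • z x) 2 ν :=
  (memLp_norm_rpow_smul_and_lpNorm_le_of_lt hγ₀ hγ₂ hf hz₂ hz₆ (lt_add_one _)).1

theorem lpNorm_norm_rpow_smul_le {A : ℝ} (hγ₀ : 0 ≤ γ) (hγ₂ : γ ≤ 2) (hf : MemLp f 6 ν)
    (hz₂ : MemLp z 2 ν) (hz₆ : MemLp z 6 ν) (hA : lpNorm f 6 ν ≤ A) :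
    lpNorm (fun x => ‖f x‖ ^ γ • z x) 2 ν ≤ A ^ γ * (lpNorm z 2 ν + lpNorm z 6 ν) := by
  have hlim : Tendsto (fun c : ℝ => c ^ γ * (lpNorm z 2 ν + lpNorm z 6 ν)) (𝓝[>] A)
      (𝓝 (A ^ γ * (lpNorm z 2 ν + lpNorm z 6 ν))) :=
    (((Real.continuous_rpow_const hγ₀).tendsto A).mono_left nhdsWithin_le_nhds).mul_const _
  refine ge_of_tendsto hlim (eventually_mem_nhdsWithin.mono fun c hc => ?_)
  exact (memLp_norm_rpow_smul_and_lpNorm_le_of_lt hγ₀ hγ₂ hf hz₂ hz₆ (hA.trans_lt hc)).2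

theorem lpNorm_norm_rpow_smul_sub_le {A : ℝ} (hγ₀ : 0 ≤ γ) (hγ₂ : γ ≤ 2) (hf₂ : MemLp f 2 ν)
    (hf₆ : MemLp f 6 ν) (hg₂ : MemLp g 2 ν) (hg₆ : MemLp g 6 ν) (hfA : lpNorm f 6 ν ≤ A)
    (hgA : lpNorm g 6 ν ≤ A) :
    lpNorm (fun x => ‖f x‖ ^ γ • f x - ‖g x‖ ^ γ • g x) 2 ν ≤
      6 * A ^ γ * (lpNorm (f - g) 2 ν + lpNorm (f - g) 6 ν) := by
  have hz₂ : MemLp (f - g) 2 ν := hf₂.sub hg₂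
  have hz₆ : MemLp (f - g) 6 ν := hf₆.sub hg₆
  have hfz := memLp_norm_rpow_smul hγ₀ hγ₂ hf₆ hz₂ hz₆
  have hgz := memLp_norm_rpow_smul hγ₀ hγ₂ hg₆ hz₂ hz₆
  have hpt (x : α) : ‖‖f x‖ ^ γ • f x - ‖g x‖ ^ γ • g x‖ ≤
      3 * (‖‖f x‖ ^ γ • (f - g) x‖ + ‖‖g x‖ ^ γ • (f - g) x‖) := by
    rw [norm_smul, norm_smul, Real.norm_of_nonneg (by positivity),
      Real.norm_of_nonneg (by positivity), ← add_mul]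
    exact norm_rpow_smul_sub_le hγ₀ hγ₂ (f x) (g x)
  calc lpNorm (fun x => ‖f x‖ ^ γ • f x - ‖g x‖ ^ γ • g x) 2 ν
      ≤ lpNorm ((3 : ℝ) • ((fun x => ‖‖f x‖ ^ γ • (f - g) x‖) +
          fun x => ‖‖g x‖ ^ γ • (f - g) x‖)) 2 ν :=
        lpNorm_mono_real ((hfz.norm.add hgz.norm).const_mul 3) hpt
    _ ≤ 3 * (lpNorm (fun x => ‖f x‖ ^ γ • (f - g) x) 2 ν +
          lpNorm (fun x => ‖g x‖ ^ γ • (f - g) x) 2 ν) := by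
        rw [lpNorm_const_smul, coe_nnnorm, Real.norm_of_nonneg (by positivity)]
        gcongr
        refine (lpNorm_add_le hfz.norm one_le_two).trans_eq ?_
        rw [lpNorm_norm hfz.1, lpNorm_norm hgz.1]
    _ ≤ 3 * (A ^ γ * (lpNorm (f - g) 2 ν + lpNorm (f - g) 6 ν) +
          A ^ γ * (lpNorm (f - g) 2 ν + lpNorm (f - g) 6 ν)) := by
        gcongr
        · exact lpNorm_norm_rpow_smul_le hγ₀ hγ₂ hf₆ hz₂ hz₆ hfA
        · exact lpNorm_norm_rpow_smul_le hγ₀ hγ₂ hg₆ hz₂ hz₆ hgA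
    _ = 6 * A ^ γ * (lpNorm (f - g) 2 ν + lpNorm (f - g) 6 ν) := by ring

end Power

section Convection

-- Otherwise `positivity` and `gcongr` unfold `normV` when they compare it with hypotheses.
attribute [local irreducible] normV

variable {Ω : Set E3}

theorem toField_add (u v : V Ω) : toField (u + v) = toField u + toField v := rfl

theorem toField_smul (c : ℝ) (u : V Ω) : toField (c • u) = c • toField u := rfl

theorem memLp_three (u : V Ω) : MemLp (toField u : E3 → E3) 3 (volume.restrict Ω) :=
  memLp_of_exponent_mem_Icc (by simp) (by simp) ⟨by norm_num, by norm_num⟩ (memLp_two u)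
    (memLp_six u)

theorem sq_lpNorm_three_le_mul_normV (u : V Ω) :
    lpNorm (toField u : E3 → E3) 3 (volume.restrict Ω) ^ 2 ≤
      sobolevConst * (‖toField u‖ * normV u) := by
  calc lpNorm (toField u : E3 → E3) 3 (volume.restrict Ω) ^ 2
      ≤ ‖toField u‖ * (sobolevConst * normV u) := by
        refine (sq_lpNorm_three_le (memLp_two u) (memLp_six u)).trans ?_
        rw [lpNorm_two_eq_norm]
        gcongr
        exact lpNorm_six_le u
    _ = sobolevConst * (‖toField u‖ * normV u) := by ring

theorem lpNorm_three_le_mul_norm (u : V Ω) :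
    lpNorm (toField u : E3 → E3) 3 (volume.restrict Ω) ≤ √sobolevConst * ‖u‖ := by
  refine abs_le_of_sq_le_sq' ?_ (by positivity) |>.2
  calc lpNorm (toField u : E3 → E3) 3 (volume.restrict Ω) ^ 2
      ≤ sobolevConst * (‖toField u‖ * normV u) := sq_lpNorm_three_le_mul_normV u
    _ ≤ sobolevConst * (‖u‖ * ‖u‖) := by
        gcongr
        exacts [sobolevConst_nonneg, normV_nonneg u, norm_toField_le u, normV_le_norm u]
    _ = (√sobolevConst * ‖u‖) ^ 2 := by
        rw [mul_pow, Real.sq_sqrt sobolevConst_nonneg, sq ‖u‖]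

/-- The integrand `∑_{i,j} uᵢ (∂vⱼ/∂xᵢ) wⱼ` of the trilinear form `b`. -/
noncomputable def bIntegrand (u v w : V Ω) (x : E3) : ℝ :=
  ∑ i : Fin 3, ∑ j : Fin 3,
    (toField u : E3 → E3) x i * (grad v i : E3 → E3) x j * (toField w : E3 → E3) x j

theorem b_eq_integral_bIntegrand (u v w : V Ω) : b u v w = ∫ x in Ω, bIntegrand u v w x := rfl

theorem norm_bIntegrand_le (u v w : V Ω) (x : E3) :
    ‖bIntegrand u v w x‖ ≤ ∑ i : Fin 3, ‖(toField u : E3 → E3) x‖ *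
      ‖(toField w : E3 → E3) x‖ * ‖(grad v i : E3 → E3) x‖ := by
  refine norm_sum_le_of_le _ fun i _ => ?_
  have hinner : ∑ j : Fin 3, (toField u : E3 → E3) x i * (grad v i : E3 → E3) x j *
      (toField w : E3 → E3) x j = (toField u : E3 → E3) x i *
        inner ℝ ((toField w : E3 → E3) x) ((grad v i : E3 → E3) x) := by
    rw [PiLp.inner_apply, Finset.mul_sum]
    exact Finset.sum_congr rfl fun j _ => by simp [mul_assoc]
  rw [hinner, norm_mul, mul_assoc]
  gcongr
  · exact PiLp.norm_apply_le _ i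
  · exact norm_inner_le_norm _ _

theorem integrable_bIntegrand_majorant (u v w : V Ω) (i : Fin 3) :
    Integrable (fun x => ‖(toField u : E3 → E3) x‖ * ‖(toField w : E3 → E3) x‖ *
      ‖(grad v i : E3 → E3) x‖) (volume.restrict Ω) :=
  integrable_norm_mul_norm_mul_norm (r := 2) (memLp_six u) (memLp_three w) (Lp.memLp (grad v i))

theorem integrable_bIntegrand (u v w : V Ω) :
    Integrable (bIntegrand u v w) (volume.restrict Ω) := by
  have hcoord (g : L2 Ω) (i : Fin 3) :
      AEStronglyMeasurable (fun x => (g : E3 → E3) x i) (volume.restrict Ω) :=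
    (EuclideanSpace.proj (𝕜 := ℝ) i).continuous.comp_aestronglyMeasurable
      (Lp.aestronglyMeasurable g)
  refine Integrable.mono' (integrable_finsetSum Finset.univ fun i _ =>
    integrable_bIntegrand_majorant u v w i) ?_ (.of_forall (norm_bIntegrand_le u v w))
  exact Finset.aestronglyMeasurable_fun_sum _ fun i _ =>
    Finset.aestronglyMeasurable_fun_sum _ fun j _ =>
      ((hcoord (toField u) i).mul (hcoord (grad v i) j)).mul (hcoord (toField w) j)

theorem abs_b_le (u v w : V Ω) :
    |b u v w| ≤ 3 * sobolevConst * normV u * normV v *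
      lpNorm (toField w : E3 → E3) 3 (volume.restrict Ω) := by
  have hterm (i : Fin 3) : ∫ x in Ω, ‖(toField u : E3 → E3) x‖ * ‖(toField w : E3 → E3) x‖ *
      ‖(grad v i : E3 → E3) x‖ ≤ sobolevConst * normV u *
        lpNorm (toField w : E3 → E3) 3 (volume.restrict Ω) * normV v := by
    refine (integral_norm_mul_norm_mul_norm_le (r := 2) (memLp_six u) (memLp_three w)
      (Lp.memLp (grad v i))).trans ?_
    rw [lpNorm_two_eq_norm]
    have hK := mul_nonneg sobolevConst_nonneg (normV_nonneg u)
    gcongr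
    exacts [mul_nonneg hK lpNorm_nonneg, lpNorm_nonneg, lpNorm_six_le u, norm_grad_apply_le v i]
  calc |b u v w|
      ≤ ∫ x in Ω, ∑ i : Fin 3, ‖(toField u : E3 → E3) x‖ * ‖(toField w : E3 → E3) x‖ *
          ‖(grad v i : E3 → E3) x‖ :=
        norm_integral_le_of_norm_le (integrable_finsetSum _ fun i _ =>
          integrable_bIntegrand_majorant u v w i) (.of_forall (norm_bIntegrand_le u v w))
    _ ≤ ∑ _i : Fin 3, sobolevConst * normV u *
          lpNorm (toField w : E3 → E3) 3 (volume.restrict Ω) * normV v := by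
        rw [integral_finsetSum _ fun i _ => integrable_bIntegrand_majorant u v w i]
        exact Finset.sum_le_sum fun i _ => hterm i
    _ = 3 * sobolevConst * normV u * normV v *
          lpNorm (toField w : E3 → E3) 3 (volume.restrict Ω) := by
        rw [Finset.sum_const, Finset.card_univ, Fintype.card_fin, nsmul_eq_mul]
        push_cast
        ring

theorem b_sub_left (u u' v w : V Ω) : b (u - u') v w = b u v w - b u' v w := by
  simp only [b_eq_integral_bIntegrand]
  rw [← integral_sub (integrable_bIntegrand u v w) (integrable_bIntegrand u' v w)]
  refine integral_congr_ae ?_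
  filter_upwards [Lp.coeFn_sub (toField u) (toField u')] with x hx
  simp only [bIntegrand, toField_sub, hx, Pi.sub_apply, PiLp.sub_apply, sub_mul,
    Finset.sum_sub_distrib]

theorem b_sub_mid (u v v' w : V Ω) : b u (v - v') w = b u v w - b u v' w := by
  simp only [b_eq_integral_bIntegrand]
  rw [← integral_sub (integrable_bIntegrand u v w) (integrable_bIntegrand u v' w)]
  refine integral_congr_ae ?_
  filter_upwards [eventually_countable_forall.2 fun i => Lp.coeFn_sub (grad v i) (grad v' i)]
    with x hx
  simp only [bIntegrand, grad_sub, PiLp.sub_apply, hx, Pi.sub_apply, mul_sub, sub_mul,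
    Finset.sum_sub_distrib]

theorem b_add_right (u v w w' : V Ω) : b u v (w + w') = b u v w + b u v w' := by
  simp only [b_eq_integral_bIntegrand]
  rw [← integral_add (integrable_bIntegrand u v w) (integrable_bIntegrand u v w')]
  refine integral_congr_ae ?_
  filter_upwards [Lp.coeFn_add (toField w) (toField w')] with x hx
  simp only [bIntegrand, toField_add, hx, Pi.add_apply, PiLp.add_apply, mul_add,
    Finset.sum_add_distrib]

theorem b_smul_right (c : ℝ) (u v w : V Ω) : b u v (c • w) = c * b u v w := by
  simp only [b_eq_integral_bIntegrand, ← integral_const_mul]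
  refine integral_congr_ae ?_
  filter_upwards [Lp.coeFn_smul c (toField w)] with x hx
  simp only [bIntegrand, toField_smul, hx, Pi.smul_apply, PiLp.smul_apply, smul_eq_mul,
    mul_left_comm _ c, Finset.mul_sum]

variable {N : ℝ}

theorem bN_sub_bN_eq (u v w : V Ω) : bN N u u w - bN N v v w =
    cutoff N (normV u) * b (u - v) u w + cutoff N (normV u) * b v (u - v) w -
      (cutoff N (normV v) - cutoff N (normV u)) * b v v w := by
  rw [b_sub_left, b_sub_mid, bN, bN]
  ring

theorem abs_bN_sub_le (hN : 0 < N) (u v w : V Ω) :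
    |bN N u u w - bN N v v w| ≤ 12 * sobolevConst * N * normV (u - v) *
      lpNorm (toField w : E3 → E3) 3 (volume.restrict Ω) := by
  wlog h : normV v ≤ normV u generalizing u v
  · rw [abs_sub_comm, normV_sub_comm]
    exact this v u (le_of_not_ge h)
  have hn : 0 ≤ normV (u - v) := normV_nonneg (u - v)
  have hF : 0 ≤ cutoff N (normV u) := cutoff_nonneg hN (normV_nonneg u)
  have hFs : 0 ≤ cutoff N (normV v) - cutoff N (normV u) :=
    sub_nonneg.2 (cutoff_anti hN (normV_nonneg v) h)
  have hFu : cutoff N (normV u) * normV u ≤ N := cutoff_mul_le hN (normV_nonneg u)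
  have hFv : cutoff N (normV u) * normV v ≤ N := (mul_le_mul_of_nonneg_left h hF).trans hFu
  have hdiff : (cutoff N (normV v) - cutoff N (normV u)) * normV v ^ 2 ≤ 2 * N * normV (u - v) :=
    (cutoff_sub_mul_sq_le hN (normV_nonneg v) h).trans
      (mul_le_mul_of_nonneg_left (normV_sub_normV_le u v) (by positivity))
  have hKz : 0 ≤ 3 * sobolevConst * lpNorm (toField w : E3 → E3) 3 (volume.restrict Ω) :=
    mul_nonneg (mul_nonneg zero_le_three sobolevConst_nonneg) lpNorm_nonneg
  calc |bN N u u w - bN N v v w|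
      ≤ cutoff N (normV u) * |b (u - v) u w| + cutoff N (normV u) * |b v (u - v) w| +
          (cutoff N (normV v) - cutoff N (normV u)) * |b v v w| := by
        rw [bN_sub_bN_eq]
        refine (abs_sub _ _).trans ((add_le_add_left (abs_add_le _ _) _).trans_eq ?_)
        rw [abs_mul, abs_mul, abs_mul, abs_of_nonneg hF, abs_of_nonneg hFs]
    _ ≤ 3 * sobolevConst * lpNorm (toField w : E3 → E3) 3 (volume.restrict Ω) *
          (cutoff N (normV u) * normV u * normV (u - v) +
            cutoff N (normV u) * normV v * normV (u - v) +
            (cutoff N (normV v) - cutoff N (normV u)) * normV v ^ 2) := by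
        linarith [mul_le_mul_of_nonneg_left (abs_b_le (u - v) u w) hF,
          mul_le_mul_of_nonneg_left (abs_b_le v (u - v) w) hF,
          mul_le_mul_of_nonneg_left (abs_b_le v v w) hFs]
    _ ≤ 3 * sobolevConst * lpNorm (toField w : E3 → E3) 3 (volume.restrict Ω) *
          (N * normV (u - v) + N * normV (u - v) + 2 * N * normV (u - v)) := by gcongr
    _ = 12 * sobolevConst * N * normV (u - v) *
          lpNorm (toField w : E3 → E3) 3 (volume.restrict Ω) := by ring

end Convection

section Damping

attribute [local irreducible] normV

variable {Ω : Set E3} {N β : ℝ}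

theorem memLp_powerField (hβ₁ : 1 ≤ β) (hβ₃ : β ≤ 3) (u : V Ω) :
    MemLp (fun x => ‖(toField u : E3 → E3) x‖ ^ (β - 1) • (toField u : E3 → E3) x) 2
      (volume.restrict Ω) :=
  memLp_norm_rpow_smul (by linarith) (by linarith) (memLp_six u) (memLp_two u) (memLp_six u)

/-- The damping term `|u|^{β-1} u` as an element of `(L²(Ω))³`; for `1 ≤ β ≤ 3` it is square
integrable because `u ∈ (L²(Ω))³ ∩ (L⁶(Ω))³`. -/
noncomputable def powerField (hβ₁ : 1 ≤ β) (hβ₃ : β ≤ 3) (u : V Ω) : L2 Ω :=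
  (memLp_powerField hβ₁ hβ₃ u).toLp

theorem coeFn_powerField (hβ₁ : 1 ≤ β) (hβ₃ : β ≤ 3) (u : V Ω) :
    (powerField hβ₁ hβ₃ u : E3 → E3) =ᵐ[volume.restrict Ω]
      fun x => ‖(toField u : E3 → E3) x‖ ^ (β - 1) • (toField u : E3 → E3) x :=
  (memLp_powerField hβ₁ hβ₃ u).coeFn_toLp

theorem damping_eq_inner (hβ₁ : 1 ≤ β) (hβ₃ : β ≤ 3) (u w : V Ω) :
    damping β u w = inner ℝ (powerField hβ₁ hβ₃ u) (toField w) := by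
  rw [L2.inner_def]
  refine integral_congr_ae ?_
  filter_upwards [coeFn_powerField hβ₁ hβ₃ u] with x hx
  rw [hx, real_inner_smul_left]

theorem lpNorm_toField_sub (p : ℝ≥0∞) (u v : V Ω) :
    lpNorm ((toField u : E3 → E3) - (toField v : E3 → E3)) p (volume.restrict Ω) =
      lpNorm (toField (u - v) : E3 → E3) p (volume.restrict Ω) :=
  lpNorm_congr_ae (Lp.coeFn_sub (toField u) (toField v)).symm

theorem norm_powerField_le (hβ₁ : 1 ≤ β) (hβ₃ : β ≤ 3) (u : V Ω) :
    ‖powerField hβ₁ hβ₃ u‖ ≤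
      (sobolevConst * normV u) ^ (β - 1) * (‖toField u‖ + sobolevConst * normV u) := by
  rw [← lpNorm_two_eq_norm (powerField hβ₁ hβ₃ u),
    lpNorm_congr_ae (coeFn_powerField hβ₁ hβ₃ u), ← lpNorm_two_eq_norm (toField u)]
  refine (lpNorm_norm_rpow_smul_le (by linarith) (by linarith) (memLp_six u) (memLp_two u)
    (memLp_six u) (lpNorm_six_le u)).trans ?_
  have hK := mul_nonneg sobolevConst_nonneg (normV_nonneg u)
  gcongr
  exact lpNorm_six_le u

theorem norm_powerField_sub_le (hβ₁ : 1 ≤ β) (hβ₃ : β ≤ 3) {u v : V Ω} (h : normV v ≤ normV u) :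
    ‖powerField hβ₁ hβ₃ u - powerField hβ₁ hβ₃ v‖ ≤ 6 * (sobolevConst * normV u) ^ (β - 1) *
      (‖toField (u - v)‖ + sobolevConst * normV (u - v)) := by
  have hsub : (↑(powerField hβ₁ hβ₃ u - powerField hβ₁ hβ₃ v) : E3 → E3) =ᵐ[volume.restrict Ω]
      fun x => ‖(toField u : E3 → E3) x‖ ^ (β - 1) • (toField u : E3 → E3) x -
        ‖(toField v : E3 → E3) x‖ ^ (β - 1) • (toField v : E3 → E3) x :=
    (Lp.coeFn_sub _ _).trans ((coeFn_powerField hβ₁ hβ₃ u).sub (coeFn_powerField hβ₁ hβ₃ v))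
  have hv : lpNorm (toField v : E3 → E3) 6 (volume.restrict Ω) ≤ sobolevConst * normV u :=
    (lpNorm_six_le v).trans (mul_le_mul_of_nonneg_left h sobolevConst_nonneg)
  have hK := mul_nonneg sobolevConst_nonneg (normV_nonneg u)
  rw [← lpNorm_two_eq_norm (_ - _), lpNorm_congr_ae hsub, ← lpNorm_two_eq_norm (toField (u - v))]
  refine (lpNorm_norm_rpow_smul_sub_le (by linarith) (by linarith) (memLp_two u) (memLp_six u)
    (memLp_two v) (memLp_six v) (lpNorm_six_le u) hv).trans ?_
  rw [lpNorm_toField_sub, lpNorm_toField_sub]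
  gcongr
  exact lpNorm_six_le (u - v)

/-- The truncated damping term `F_N(‖u‖^{β-1}) |u|^{β-1} u` as an element of `(L²(Ω))³`. -/
noncomputable def cutoffPowerField (N : ℝ) (hβ₁ : 1 ≤ β) (hβ₃ : β ≤ 3) (u : V Ω) : L2 Ω :=
  cutoff N (normV u ^ (β - 1)) • powerField hβ₁ hβ₃ u

theorem norm_cutoffPowerField_sub_le (hN : 0 < N) (hβ₁ : 1 ≤ β) (hβ₃ : β ≤ 3) {u v : V Ω}
    (h : normV v ≤ normV u) :
    ‖cutoffPowerField N hβ₁ hβ₃ u - cutoffPowerField N hβ₁ hβ₃ v‖ ≤ sobolevConst ^ (β - 1) *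
      (6 * N * (‖toField (u - v)‖ + sobolevConst * normV (u - v)) +
        (cutoff N (normV v ^ (β - 1)) - cutoff N (normV u ^ (β - 1))) * normV v ^ (β - 1) *
          (‖toField v‖ + sobolevConst * normV v)) := by
  have hK := sobolevConst_nonneg
  have hr := normV_nonneg u
  have hs := normV_nonneg v
  have hn := normV_nonneg (u - v)
  have hF : 0 ≤ cutoff N (normV u ^ (β - 1)) := cutoff_nonneg hN (by positivity)
  have hFr : cutoff N (normV u ^ (β - 1)) * normV u ^ (β - 1) ≤ N :=
    cutoff_mul_le hN (by positivity)
  have hFs : 0 ≤ cutoff N (normV v ^ (β - 1)) - cutoff N (normV u ^ (β - 1)) :=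
    sub_nonneg.2 (cutoff_anti hN (by positivity) (Real.rpow_le_rpow hs h (by linarith)))
  calc ‖cutoffPowerField N hβ₁ hβ₃ u - cutoffPowerField N hβ₁ hβ₃ v‖
      = ‖cutoff N (normV u ^ (β - 1)) • (powerField hβ₁ hβ₃ u - powerField hβ₁ hβ₃ v) -
          (cutoff N (normV v ^ (β - 1)) - cutoff N (normV u ^ (β - 1))) •
            powerField hβ₁ hβ₃ v‖ := by
        congr 1
        simp only [cutoffPowerField]
        module
    _ ≤ cutoff N (normV u ^ (β - 1)) * (6 * (sobolevConst * normV u) ^ (β - 1) *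
          (‖toField (u - v)‖ + sobolevConst * normV (u - v))) +
        (cutoff N (normV v ^ (β - 1)) - cutoff N (normV u ^ (β - 1))) *
          ((sobolevConst * normV v) ^ (β - 1) * (‖toField v‖ + sobolevConst * normV v)) := by
        refine (norm_sub_le _ _).trans ?_
        rw [norm_smul, norm_smul, Real.norm_of_nonneg hF, Real.norm_of_nonneg hFs]
        gcongr
        exacts [norm_powerField_sub_le hβ₁ hβ₃ h, norm_powerField_le hβ₁ hβ₃ v]
    _ = sobolevConst ^ (β - 1) * (6 * (cutoff N (normV u ^ (β - 1)) * normV u ^ (β - 1)) *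
          (‖toField (u - v)‖ + sobolevConst * normV (u - v)) +
        (cutoff N (normV v ^ (β - 1)) - cutoff N (normV u ^ (β - 1))) * normV v ^ (β - 1) *
          (‖toField v‖ + sobolevConst * normV v)) := by
        rw [Real.mul_rpow hK hr, Real.mul_rpow hK hs]
        ring
    _ ≤ _ := by gcongr

theorem exists_norm_cutoffPowerField_sub_le (hN : 0 < N) (hβ₁ : 1 ≤ β) (hβ₃ : β ≤ 3) (S : ℝ) :
    ∃ L, 0 ≤ L ∧ ∀ u v : V Ω, ‖toField u‖ ≤ S → ‖toField v‖ ≤ S →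
      ‖cutoffPowerField N hβ₁ hβ₃ u - cutoffPowerField N hβ₁ hβ₃ v‖ ≤
        L * (normV (u - v) + ‖toField (u - v)‖) := by
  have hK := sobolevConst_nonneg
  obtain ⟨C, hC_nonneg, hC⟩ := exists_cutoff_rpow_sub_mul_add_le hN (γ := β - 1) (by linarith)
    (by linarith) (abs_nonneg S) hK
  refine ⟨sobolevConst ^ (β - 1) * (6 * N * (1 + sobolevConst) + C), by positivity,
    fun u v hu hv => ?_⟩
  wlog h : normV v ≤ normV u generalizing u v
  · rw [norm_sub_rev, normV_sub_comm, ← norm_neg (toField (u - v)), ← toField_neg, neg_sub]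
    exact this v u hv hu (le_of_not_ge h)
  have hn := normV_nonneg (u - v)
  have hs := normV_nonneg v
  have hFs : 0 ≤ cutoff N (normV v ^ (β - 1)) - cutoff N (normV u ^ (β - 1)) :=
    sub_nonneg.2 (cutoff_anti hN (by positivity) (Real.rpow_le_rpow hs h (by linarith)))
  have hcut : (cutoff N (normV v ^ (β - 1)) - cutoff N (normV u ^ (β - 1))) *
      normV v ^ (β - 1) * (‖toField v‖ + sobolevConst * normV v) ≤ C * normV (u - v) :=
    calc (cutoff N (normV v ^ (β - 1)) - cutoff N (normV u ^ (β - 1))) * normV v ^ (β - 1) *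
          (‖toField v‖ + sobolevConst * normV v)
        ≤ (cutoff N (normV v ^ (β - 1)) - cutoff N (normV u ^ (β - 1))) * normV v ^ (β - 1) *
            (|S| + sobolevConst * normV v) := by
          gcongr
          exact hv.trans (le_abs_self S)
      _ ≤ C * (normV u - normV v) := hC _ _ hs h
      _ ≤ C * normV (u - v) := by
          gcongr
          exact normV_sub_normV_le u v
  refine (norm_cutoffPowerField_sub_le hN hβ₁ hβ₃ h).trans ?_
  rw [mul_assoc (sobolevConst ^ (β - 1))]
  refine mul_le_mul_of_nonneg_left ((add_le_add_right hcut _).trans ?_) (by positivity)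
  have hspare : 0 ≤ 6 * N * normV (u - v) + 6 * N * sobolevConst * ‖toField (u - v)‖ +
      C * ‖toField (u - v)‖ := by positivity
  linarith

end Damping

section Operator

attribute [local irreducible] normV

variable {Ω : Set E3} {μ α β N : ℝ}

/-- The convection term `b(u,v,·)` as an element of the dual of `V`. -/
noncomputable def convection (u v : V Ω) : StrongDual ℝ (V Ω) :=
  LinearMap.mkContinuous
    { toFun := fun w => b u v w
      map_add' := b_add_right u v
      map_smul' := fun c w => b_smul_right c u v w }
    (3 * sobolevConst * normV u * normV v * √sobolevConst) fun w => by
      have hK := sobolevConst_nonneg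
      have hu := normV_nonneg u
      have hv := normV_nonneg v
      rw [mul_assoc _ (√sobolevConst)]
      refine (abs_b_le u v w).trans ?_
      gcongr
      exact lpNorm_three_le_mul_norm w

/-- The operator `u ↦ μ((u,·)) + b_N(u,u,·) + α F_N(‖u‖^{β-1}) (|u|^{β-1}u, ·)` from `V` to its
dual. -/
noncomputable def operator (μ α N : ℝ) (hβ₁ : 1 ≤ β) (hβ₃ : β ≤ 3) (u : V Ω) :
    StrongDual ℝ (V Ω) :=
  μ • (innerSL ℝ (grad u)).comp (gradL Ω) + cutoff N (normV u) • convection u u +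
    α • (innerSL ℝ (cutoffPowerField N hβ₁ hβ₃ u)).comp (toFieldL Ω)

theorem operator_apply_eq_inner (hβ₁ : 1 ≤ β) (hβ₃ : β ≤ 3) (u w : V Ω) :
    operator μ α N hβ₁ hβ₃ u w = μ * innerV u w + bN N u u w +
      α * inner ℝ (cutoffPowerField N hβ₁ hβ₃ u) (toField w) := rfl

theorem operator_apply (hβ₁ : 1 ≤ β) (hβ₃ : β ≤ 3) (u w : V Ω) :
    operator μ α N hβ₁ hβ₃ u w = μ * innerV u w + bN N u u w +
      α * (cutoff N (normV u ^ (β - 1)) * damping β u w) := by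
  rw [operator_apply_eq_inner, cutoffPowerField, real_inner_smul_left, damping_eq_inner hβ₁ hβ₃]

theorem exists_abs_operator_sub_sub_le (hβ₁ : 1 ≤ β) (hβ₃ : β ≤ 3) (hN : 0 < N) (S : ℝ) :
    ∃ L, 0 ≤ L ∧ ∀ u v w : V Ω, ‖toField u‖ ≤ S → ‖toField v‖ ≤ S →
      |(operator μ α N hβ₁ hβ₃ u - operator μ α N hβ₁ hβ₃ v) w - μ * innerV (u - v) w| ≤
        L * ((normV (u - v) + ‖toField (u - v)‖) *
          (lpNorm (toField w : E3 → E3) 3 (volume.restrict Ω) + ‖toField w‖)) := by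
  obtain ⟨L, hL_nonneg, hL⟩ := exists_norm_cutoffPowerField_sub_le (Ω := Ω) hN hβ₁ hβ₃ S
  have hK := sobolevConst_nonneg
  refine ⟨12 * sobolevConst * N + |α| * L, by positivity, fun u v w hu hv => ?_⟩
  have hn := normV_nonneg (u - v)
  have hx : 0 ≤ lpNorm (toField w : E3 → E3) 3 (volume.restrict Ω) := lpNorm_nonneg
  have hsplit : (operator μ α N hβ₁ hβ₃ u - operator μ α N hβ₁ hβ₃ v) w - μ * innerV (u - v) w =
      (bN N u u w - bN N v v w) +
        α * inner ℝ (cutoffPowerField N hβ₁ hβ₃ u - cutoffPowerField N hβ₁ hβ₃ v) (toField w) := by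
    rw [sub_apply, operator_apply_eq_inner, operator_apply_eq_inner, inner_sub_left,
      innerV_sub_left]
    ring
  calc |(operator μ α N hβ₁ hβ₃ u - operator μ α N hβ₁ hβ₃ v) w - μ * innerV (u - v) w|
      ≤ |bN N u u w - bN N v v w| + |α| *
          |inner ℝ (cutoffPowerField N hβ₁ hβ₃ u - cutoffPowerField N hβ₁ hβ₃ v) (toField w)| := by
        rw [hsplit, ← abs_mul]
        exact abs_add_le _ _
    _ ≤ 12 * sobolevConst * N * normV (u - v) *
          lpNorm (toField w : E3 → E3) 3 (volume.restrict Ω) +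
        |α| * (L * (normV (u - v) + ‖toField (u - v)‖) * ‖toField w‖) := by
        gcongr
        · exact abs_bN_sub_le hN u v w
        · refine (abs_real_inner_le_norm _ _).trans ?_
          gcongr
          exact hL u v hu hv
    _ ≤ _ := by
        have hspare : 0 ≤ 12 * sobolevConst * N * (normV (u - v) * ‖toField w‖ +
            ‖toField (u - v)‖ * (lpNorm (toField w : E3 → E3) 3 (volume.restrict Ω) +
              ‖toField w‖)) +
            |α| * L * (normV (u - v) + ‖toField (u - v)‖) *
              lpNorm (toField w : E3 → E3) 3 (volume.restrict Ω) := by positivity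
        linarith

theorem exists_lipschitzOnWith_operator (hβ₁ : 1 ≤ β) (hβ₃ : β ≤ 3) (hN : 0 < N) (S : ℝ) :
    ∃ L, LipschitzOnWith L (operator μ α N hβ₁ hβ₃) {u : V Ω | ‖toFieldL Ω u‖ ≤ S} := by
  obtain ⟨L, hL_nonneg, hL⟩ :=
    exists_abs_operator_sub_sub_le (Ω := Ω) (μ := μ) (α := α) hβ₁ hβ₃ hN S
  refine ⟨Real.toNNReal (|μ| + L * (2 * (√sobolevConst + 1))),
    LipschitzOnWith.of_dist_le_mul fun u hu v hv => ?_⟩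
  rw [Real.coe_toNNReal _ (by positivity), dist_eq_norm, dist_eq_norm]
  refine ContinuousLinearMap.opNorm_le_bound _ (by positivity) fun w => ?_
  have hlow : |μ * innerV (u - v) w| ≤ |μ| * (‖u - v‖ * ‖w‖) := by
    rw [abs_mul]
    gcongr
    exact (abs_innerV_le _ _).trans
      (mul_le_mul (normV_le_norm _) (normV_le_norm w) (normV_nonneg w) (norm_nonneg _))
  have hrest : (normV (u - v) + ‖toField (u - v)‖) *
      (lpNorm (toField w : E3 → E3) 3 (volume.restrict Ω) + ‖toField w‖) ≤
        (‖u - v‖ + ‖u - v‖) * (√sobolevConst * ‖w‖ + ‖w‖) := by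
    gcongr
    exacts [add_nonneg lpNorm_nonneg (norm_nonneg _), normV_le_norm _, norm_toField_le _,
      lpNorm_three_le_mul_norm w, norm_toField_le w]
  calc ‖(operator μ α N hβ₁ hβ₃ u - operator μ α N hβ₁ hβ₃ v) w‖
      ≤ |μ * innerV (u - v) w| + L * ((normV (u - v) + ‖toField (u - v)‖) *
          (lpNorm (toField w : E3 → E3) 3 (volume.restrict Ω) + ‖toField w‖)) := by
        rw [Real.norm_eq_abs]
        linarith [hL u v w hu hv, abs_sub_abs_le_abs_sub
          ((operator μ α N hβ₁ hβ₃ u - operator μ α N hβ₁ hβ₃ v) w) (μ * innerV (u - v) w)]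
    _ ≤ |μ| * (‖u - v‖ * ‖w‖) +
          L * ((‖u - v‖ + ‖u - v‖) * (√sobolevConst * ‖w‖ + ‖w‖)) := by gcongr
    _ = (|μ| + L * (2 * (√sobolevConst + 1))) * ‖u - v‖ * ‖w‖ := by ring

theorem exists_mul_add_mul_add_le {K L : ℝ} (hμ : 0 < μ) (hL : 0 ≤ L) :
    ∃ C, ∀ a n x : ℝ, x ^ 2 ≤ K * (a * n) →
      L * ((n + a) * (x + a)) ≤ μ * n ^ 2 + C * a ^ 2 := by
  refine ⟨(L ^ 2 * K / μ) ^ 2 / μ + L ^ 2 / μ + L / 2 + (L * K / 2) ^ 2 / μ + L,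
    fun a n x hx => ?_⟩
  have hyoung (y : ℝ) : n * y ≤ μ / 4 * n ^ 2 + y ^ 2 / μ := by
    have hsq : 0 ≤ (μ / 2 * n - y) ^ 2 / μ := by positivity
    have hexp : (μ / 2 * n - y) ^ 2 / μ = μ / 4 * n ^ 2 - n * y + y ^ 2 / μ := by
      field_simp
      ring
    linarith
  have hnx : n * (L * x) ≤ μ / 4 * n ^ 2 + n * (L ^ 2 * K / μ * a) :=
    calc n * (L * x) ≤ μ / 4 * n ^ 2 + L ^ 2 / μ * x ^ 2 := (hyoung _).trans_eq (by ring)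
      _ ≤ μ / 4 * n ^ 2 + L ^ 2 / μ * (K * (a * n)) := by gcongr
      _ = μ / 4 * n ^ 2 + n * (L ^ 2 * K / μ * a) := by ring
  have hax : L * (a * x) ≤ L / 2 * a ^ 2 + n * (L * K / 2 * a) :=
    calc L * (a * x) ≤ L / 2 * a ^ 2 + L / 2 * x ^ 2 := by
          linarith [mul_nonneg hL (sq_nonneg (a - x))]
      _ ≤ L / 2 * a ^ 2 + L / 2 * (K * (a * n)) := by gcongr
      _ = L / 2 * a ^ 2 + n * (L * K / 2 * a) := by ring
  calc L * ((n + a) * (x + a)) = n * (L * x) + n * (L * a) + L * (a * x) + L * a ^ 2 := by ring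
    _ ≤ (μ / 4 * n ^ 2 + (μ / 4 * n ^ 2 + (L ^ 2 * K / μ * a) ^ 2 / μ)) +
          (μ / 4 * n ^ 2 + (L * a) ^ 2 / μ) +
          (L / 2 * a ^ 2 + (μ / 4 * n ^ 2 + (L * K / 2 * a) ^ 2 / μ)) + L * a ^ 2 := by
        gcongr
        exacts [hnx.trans (by gcongr; exact hyoung _), hyoung _,
          hax.trans (by gcongr; exact hyoung _)]
    _ = _ := by ring

theorem exists_le_operator_sub_apply_sub (hμ : 0 < μ) (hβ₁ : 1 ≤ β) (hβ₃ : β ≤ 3) (hN : 0 < N)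
    (S : ℝ) : ∃ C, ∀ u v : V Ω, ‖toFieldL Ω u‖ ≤ S → ‖toFieldL Ω v‖ ≤ S →
      -(C * ‖toFieldL Ω (u - v)‖ ^ 2) ≤
        (operator μ α N hβ₁ hβ₃ u - operator μ α N hβ₁ hβ₃ v) (u - v) := by
  obtain ⟨L, hL_nonneg, hL⟩ :=
    exists_abs_operator_sub_sub_le (Ω := Ω) (μ := μ) (α := α) hβ₁ hβ₃ hN S
  obtain ⟨C, hC⟩ := exists_mul_add_mul_add_le (K := sobolevConst) hμ hL_nonneg
  refine ⟨C, fun u v hu hv => ?_⟩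
  have habsorb := hC _ _ _ (sq_lpNorm_three_le_mul_normV (u - v))
  have hdiff := neg_le_of_abs_le (hL u v (u - v) hu hv)
  rw [innerV_self] at hdiff
  rw [toFieldL_apply]
  linarith

end Operator

section WeakSolution

variable {Ω : Set E3} {μ α β N τ T : ℝ} {f u v : ℝ → H Ω} {uτ : H Ω}

theorem memLp_ofReal_add_one (hβ₁ : 1 ≤ β) (hβ₃ : β ≤ 3) (w : V Ω) :
    MemLp (toField w : E3 → E3) (ENNReal.ofReal (β + 1)) (volume.restrict Ω) := by
  refine memLp_of_exponent_mem_Icc two_ne_zero ENNReal.ofNat_ne_top ⟨?_, ?_⟩ (memLp_two w)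
    (memLp_six w)
  · rw [← ENNReal.ofReal_ofNat 2]
    exact ENNReal.ofReal_le_ofReal (by linarith)
  · rw [← ENNReal.ofReal_ofNat 6]
    exact ENNReal.ofReal_le_ofReal (by linarith)

theorem IsWeakSolution.exists_isEvolutionSolution (hβ₁ : 1 ≤ β) (hβ₃ : β ≤ 3)
    (hu : IsWeakSolution μ α β N τ T f uτ u) :
    ∃ u' : ℝ → H Ω, (∀ᵐ t ∂volume.restrict (Ioo τ T), u' t = u t) ∧ u' τ = uτ ∧
      ∃ U, IsEvolutionSolution (toFieldL Ω) (operator μ α N hβ₁ hβ₃) (fun t => (f t : L2 Ω)) τ T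
        (fun t => (u' t : L2 Ω)) U := by
  obtain ⟨hbound, ⟨u', hcont, hae, h0⟩, U, ⟨hU, hUu⟩, -, heq⟩ := hu
  refine ⟨u', hae, h0, U, hU, ?_, ⟨(eLpNorm u ⊤ (volume.restrict (Ioo τ T))).toReal, ?_⟩,
    fun z => hcont ⟨toField z, toField_mem_H z⟩, fun z φ hφ => ?_⟩
  · filter_upwards [hUu, hae] with t hUt hut
    rw [toFieldL_apply, hUt, hut]
  · filter_upwards [ae_le_eLpNormEssSup (f := u), hae] with t ht hut
    change ‖u' t‖ ≤ _
    rw [hut, ← toReal_enorm, eLpNorm_exponent_top]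
    exact ENNReal.toReal_mono (by simpa using hbound.2.ne) ht
  · obtain ⟨hsmooth, hcomp, hsupp⟩ := hφ
    simp only [toFieldL_apply, operator_apply]
    rw [← heq z (memLp_ofReal_add_one hβ₁ hβ₃ z) φ hsmooth hcomp hsupp]
    congr 2
    refine integral_congr_ae ?_
    filter_upwards [hae] with t hut
    rw [hut]

theorem IsWeakSolution.ae_eq (hμ : 0 < μ) (hβ₁ : 1 ≤ β) (hβ₃ : β ≤ 3) (hN : 0 < N) (hT : τ < T)
    (hu : IsWeakSolution μ α β N τ T f uτ u) (hv : IsWeakSolution μ α β N τ T f uτ v) :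
    ∀ᵐ t ∂volume.restrict (Ioo τ T), u t = v t := by
  obtain ⟨u', huu', hu0, U, hU⟩ := hu.exists_isEvolutionSolution hβ₁ hβ₃
  obtain ⟨v', hvv', hv0, W, hW⟩ := hv.exists_isEvolutionSolution hβ₁ hβ₃
  have hunique := hU.unique (exists_lipschitzOnWith_operator hβ₁ hβ₃ hN)
    (exists_le_operator_sub_apply_sub hμ hβ₁ hβ₃ hN) hT hW (by rw [hu0, hv0])
  filter_upwards [hunique, huu', hvv'] with t ht hut hvt
  rw [← hut, ← hvt]
  exact Subtype.ext ht

theorem WeaklyContinuousOn.eqOn_of_ae_eq (hT : τ < T) (hu : WeaklyContinuousOn u (Icc τ T))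
    (hv : WeaklyContinuousOn v (Icc τ T)) (h : ∀ᵐ t ∂volume.restrict (Ioo τ T), u t = v t) :
    EqOn u v (Icc τ T) := by
  intro t ht
  refine ext_inner_right ℝ fun z => ?_
  have hae : (fun t => inner ℝ (u t) z) =ᵐ[volume.restrict (Icc τ T)] fun t => inner ℝ (v t) z := by
    rw [← restrict_Ioo_eq_restrict_Icc]
    filter_upwards [h] with s hs
    rw [hs]
  exact Measure.eqOn_Icc_of_ae_eq volume hT.ne hae (hu z) (hv z) ht

theorem WeaklyContinuousOn.eqOn_Ici_of_ae_eq (hu : WeaklyContinuousOn u (Ici τ))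
    (hv : WeaklyContinuousOn v (Ici τ)) (h : ∀ᵐ t ∂volume.restrict (Ioi τ), u t = v t) :
    EqOn u v (Ici τ) := fun t ht =>
  WeaklyContinuousOn.eqOn_of_ae_eq (lt_of_le_of_lt ht (lt_add_one t))
    (fun z => (hu z).mono Icc_subset_Ici_self) (fun z => (hv z).mono Icc_subset_Ici_self)
    (ae_restrict_of_ae_restrict_of_subset Ioo_subset_Ioi_self h) ⟨ht, (lt_add_one t).le⟩

theorem IsGlobalWeakSolution.ae_eq (hμ : 0 < μ) (hβ₁ : 1 ≤ β) (hβ₃ : β ≤ 3) (hN : 0 < N)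
    (hu : IsGlobalWeakSolution μ α β N τ f uτ u) (hv : IsGlobalWeakSolution μ α β N τ f uτ v) :
    ∀ᵐ t ∂volume.restrict (Ioi τ), u t = v t := by
  have hcover : Ioi τ ⊆ ⋃ n : ℕ, Ioo τ (τ + (n + 1)) := by
    intro t ht
    obtain ⟨n, hn⟩ := exists_nat_gt (t - τ)
    exact mem_iUnion.2 ⟨n, ht, by linarith⟩
  refine ae_restrict_of_ae_restrict_of_subset hcover ((ae_restrict_iUnion_iff _ _).2 fun n => ?_)
  have hT : τ < τ + ((n : ℝ) + 1) := lt_add_of_pos_right _ (by positivity)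
  exact (hu _ hT).ae_eq hμ hβ₁ hβ₃ hN hT (hv _ hT)

end WeakSolution

end GMNSED

theorem mainTheorem8_general (Ω : Set GMNSED.E3)
    (μ α β N τ : ℝ) (hμ : 0 < μ) (hβ₁ : 1 ≤ β) (hβ₃ : β ≤ 3) (hN : 0 < N)
    (f : ℝ → GMNSED.H Ω) (_hf : ∀ T, τ < T → MemLp f 2 (volume.restrict (Ioo τ T)))
    (uτ : GMNSED.H Ω) :
    (∀ T, τ < T → ∀ u v : ℝ → GMNSED.H Ω,
      GMNSED.IsWeakSolution μ α β N τ T f uτ u →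
      GMNSED.IsWeakSolution μ α β N τ T f uτ v →
      (∀ᵐ t ∂volume.restrict (Ioo τ T), u t = v t) ∧
      (GMNSED.WeaklyContinuousOn u (Icc τ T) → GMNSED.WeaklyContinuousOn v (Icc τ T) →
        ∀ t ∈ Icc τ T, u t = v t)) ∧
    (∀ u v : ℝ → GMNSED.H Ω,
      GMNSED.IsGlobalWeakSolution μ α β N τ f uτ u →
      GMNSED.IsGlobalWeakSolution μ α β N τ f uτ v →
      (∀ᵐ t ∂volume.restrict (Ioi τ), u t = v t) ∧
      (GMNSED.WeaklyContinuousOn u (Ici τ) → GMNSED.WeaklyContinuousOn v (Ici τ) →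
        ∀ t ∈ Ici τ, u t = v t)) :=
  ⟨fun _T hT _u _v hu hv =>
    have hae := hu.ae_eq hμ hβ₁ hβ₃ hN hT hv
    ⟨hae, fun hcu hcv => hcu.eqOn_of_ae_eq hT hcv hae⟩,
  fun _u _v hu hv =>
    have hae := hu.ae_eq hμ hβ₁ hβ₃ hN hv
    ⟨hae, fun hcu hcv => hcu.eqOn_Ici_of_ae_eq hcv hae⟩⟩

theorem mainTheorem8 (Ω : Set GMNSED.E3) (hΩo : IsOpen Ω) (hΩb : Bornology.IsBounded Ω)
    (μ α β N τ : ℝ) (hμ : 0 < μ) (hα : 0 < α) (hβ₁ : 1 ≤ β) (hβ₃ : β ≤ 3) (hN : 0 < N)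
    (f : ℝ → GMNSED.H Ω)
    (hf : ∀ T, τ < T → MemLp f 2 (volume.restrict (Ioo τ T)))
    (uτ : GMNSED.H Ω) :
    (∀ T, τ < T → ∀ u v : ℝ → GMNSED.H Ω,
      GMNSED.IsWeakSolution μ α β N τ T f uτ u →
      GMNSED.IsWeakSolution μ α β N τ T f uτ v →
      (∀ᵐ t ∂volume.restrict (Ioo τ T), u t = v t) ∧
      (GMNSED.WeaklyContinuousOn u (Icc τ T) → GMNSED.WeaklyContinuousOn v (Icc τ T) →
        ∀ t ∈ Icc τ T, u t = v t)) ∧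
    (∀ u v : ℝ → GMNSED.H Ω,
      GMNSED.IsGlobalWeakSolution μ α β N τ f uτ u →
      GMNSED.IsGlobalWeakSolution μ α β N τ f uτ v →
      (∀ᵐ t ∂volume.restrict (Ioi τ), u t = v t) ∧
      (GMNSED.WeaklyContinuousOn u (Ici τ) → GMNSED.WeaklyContinuousOn v (Ici τ) →
        ∀ t ∈ Ici τ, u t = v t)) :=
  mainTheorem8_general Ω μ α β N τ hμ hβ₁ hβ₃ hN f hf uτ
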